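/- **Setting.** Let $G$ be a finite simple graph with node set $V$. Node $i$ has a message $m_i\in F^{k_i}$ and stores a codeword of length $n_i=k_i+r_i$, $k_i,r_i>0$, where $F$ is a finite field of characteristic $2$. A *cooperation graph* consists of: nonempty sets $M_i\subseteq V\setminus\{i\}$ (first-level partners) with $j\in M_i\iff i\in M_j$; numbers $L_i\ge 1$ of cooperation levels; and a finite family of cycles $C_t$. A cycle is a nonempty connected set of positions $(\text{row},\text{column})\in V\times V$ that meets each of its rows and each of its columns in exactly two positions; its positions satisfy $i\ne j$ and $j\notin M_i$. Let $X_{t;j}$ be the pair of rows of $C_t$ in column $j$, and $Y_{t;i}$ the pair of columns of $C_t$ in row $i$. Each $C_t$ has a group number $g_t$ and, for each of its columns $j$, a level $\ell_{t;j}\in\{2,\dots,L_j\}$. The reflection of each cycle in the diagonal is again a cycle of the family. Let $R_{j;\ell}$ be the set of all $t$ such that $C_t$ meets column $j$ and $\ell_{t;j}=\ell$; let $V_{j;\ell}=\bigcup_{t\in R_{j;\ell}}X_{t;j}$; let $T_{i;\ell}$ be the set of the reflections of the cycles in $R_{i;\ell}$; let $U_{j;g}$ be the union of the $X_{t;j}$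 over the cycles of group $g$ that meet column $j$. The cooperation graph is *compatible* with $G$ if (1) $M_i$ consists of neighbours of $i$; (2) the cycles are pairwise disjoint; (3) for each $g$, the columns of the cycles of group $g$ lie in one maximal clique of $G$; (4) for all $i$ and $2\le\ell\le L_i$ there is a unique group $g$ that meets column $i$ and has $V_{i;\ell}=U_{i;g}$. We also assume that any two distinct columns $j,j'$ of cycles of the same group are first-level partners, $j'\in M_j$ (automatic if each $M_i$ is the whole neighbourhood of $i$). **The code $\mathcal C_2$.** Fix integers $\delta_i\ge0$ and, for each row $i$ of $C_t$, $\gamma_{i;t}\ge 1$. Put $\eta_{j;\ell}=\max\{\gamma_{i;t}:t\in R_{j;\ell},\,i\in X_{t;j}\}$. Assume $\delta_i+\sum_{\ell=2}^{L_i}\eta_{i;\ell}\le r_i$, $\delta_j\le k_i$ for $j\in M_i$, and $\gamma_{i;t}\le k_i$. For each $i$ let $\mathbf T_i$ be a Cauchy matrix $\big(1/(a_x-b_y)\big)$ over $F$, all $a_x,b_y$ distinct, with $k_i+\delta_i+\sum_{\ell=2}^{L_i}\eta_{i;\ell}$ rows and $r_i+\sum_{j\in M_i}\delta_j+\sum_{2\le\ell\le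 L_i,\,t\in T_{i;\ell}}\gamma_{i;t}$ columns, partitioned as $$\mathbf T_i=\begin{bmatrix}A_{i,i}&[B_{i,j}]_{j\in M_i}\;[E_{i;\ell;t}]_{2\le\ell\le L_i,\,t\in T_{i;\ell}}\\ U_i&*\\ [V_{i;\ell}]_{2\le\ell\le L_i}&*\end{bmatrix}$$ with $A_{i,i}\in F^{k_i\times r_i}$, $B_{i,j}\in F^{k_i\times\delta_j}$, $E_{i;\ell;t}\in F^{k_i\times\gamma_{i;t}}$, $U_i\in F^{\delta_i\times r_i}$; here $V_{i;\ell}$ also denotes a matrix in $F^{\eta_{i;\ell}\times r_i}$. Put $A_{i,j}=B_{i,j}U_j$ for $j\in M_i$; $A_{i,j}=[E_{i;\ell;t},0]\,V_{j;\ell_{t;j}}$ (the bracket padded to $\eta_{j;\ell_{t;j}}$ columns) if $t\in T_{i;\ell}$ and $j\in Y_{t;i}$; and $A_{i,j}=0$ for all other $j\neq i$. Node $i$ stores $c_i=(m_i,\sum_j m_jA_{j,i})$. **EC capabilities.** A capability $e$ of node $i$ means that all sets of at most $e$ erased symbols of $c_i$ are corrected, while, if $e<n_i$, some set of $e+1$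 erased symbols is not. *Local* decoding uses the non-erased symbols of $c_i$ only. Let $A_i^1\subset A_i^2\subset\cdots$ be sets of nodes, $A_i^0=\varnothing$, $I_i^\ell=A_i^\ell\setminus A_i^{\ell-1}$. *Decoding with the first to the $\ell$-th level cooperations*, when the nodes of $A_i^\ell\cup W$ are recovered, uses: the non-erased symbols of $c_i$; the sum $\sum_{j\ne i}m_jA_{j,i}$, provided that the codewords $c_j$, $j\in A_i^\ell$, determine it; and, for all $1\le\ell'\le\ell$, the cross parities $m_iA_{i,j}$ from each helper $j\in I_i^{\ell'}$ that can compute them from $c_j$ and the messages of the nodes in $A_i^{\ell'}\cup W$. **Theorem.** The code $\mathcal C_2$ has the following EC hierarchies $(d_{i,0},\dots,d_{i,L_i})$, with sets $A_i^\ell$, $B_i^\ell$ and intermediate capabilities $\lambda_{i,\ell;W}$, for all $i\in V$. * The local capability is $d_{i,0}=r_i-\delta_i-\sum_{\ell=2}^{L_i}\eta_{i;\ell}$; further $d_{i,1}=r_i+\sum_{j\in M_i}\delta_j$ and, for $2\le\ell\le L_i$, $d_{i,\ell}=r_i+\sum_{j\in M_i}\delta_j+\sum_{2\le\ell'\le\ell,\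 t\in T_{i;\ell'}}\gamma_{i;t}$. * $I_i^1=M_i$ and $B_i^1=\bigcup_{j\in M_i}\big(M_j\setminus(\{i\}\cup M_i)\big)$. For $2\le\ell\le L_i$, $I_i^\ell=\bigcup_{t\in R_{i;\ell}}X_{t;i}=V_{i;\ell}=\bigcup_{t\in T_{i;\ell}}Y_{t;i}$ and $B_i^\ell=\bigcup_{t\in T_{i;\ell},\,j\in Y_{t;i}}\big(I_j^{\ell_{t;j}}\setminus(\{i\}\cup A_i^\ell)\big)$. For $1\le\ell\le L_i$, $A_i^{\ell-1}\subsetneq A_i^\ell$, $A_i^\ell\cap B_i^\ell=\varnothing$, and $i\notin A_i^\ell\cup B_i^\ell$. * For $1\le\ell\le L_i$ and $W\subseteq\bigcup_{1\le\ell'\le\ell}B_i^{\ell'}$, the capability of node $i$ when decoding with the first to the $\ell$-th level cooperations and the nodes of $A_i^\ell\cup W$ recovered is $$\lambda_{i,\ell;W}=r_i+\sum_{j\in M_i:\ M_j\setminus\{i\}\subseteq M_i\cup W}\delta_j+\sum_{\substack{2\le\ell'\le\ell,\ t\in T_{i;\ell'}:\\ I_j^{\ell_{t;j}}\setminus A_i^{\ell'}\subseteq\{i\}\cup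 W\text{ for some }j\in Y_{t;i}}}\gamma_{i;t}.$$ In particular any $\lambda_{i,\ell;W}$ erasures in $c_i$ can be corrected from the non-erased symbols of $c_i$ and the codewords of the nodes in $A_i^\ell\cup W$. * $\lambda_{i,\ell;\varnothing}\le\lambda_{i,\ell;W}\le d_{i,\ell}$, with $\lambda_{i,\ell;W}=d_{i,\ell}$ for $W=\bigcup_{1\le\ell'\le\ell}B_i^{\ell'}$; and no $W\subseteq V\setminus\{i\}$ whatsoever allows this decoding to correct all sets of $d_{i,\ell}+1$ erasures, if $d_{i,\ell}<n_i$. -/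

import Mathlib

/-! ### Systematic joint codes and their erasure-correction (EC) hierarchies -/

section JointCodes

variable {V F : Type*} [Fintype V] [DecidableEq V] [Field F] {k r : V → ℕ}

/-- The parity blocks `A_{i,j}` (with `k i` rows and `r j` columns) of a systematic generator
matrix of a joint code on the nodes `V`. -/
abbrev ParityBlocks (F : Type*) (k r : V → ℕ) : Type _ :=
  ∀ i j : V, Matrix (Fin (k i)) (Fin (r j)) F

/-- A joint message: `m i` is the message of length `k i` of node `i`. -/
abbrev Message (F : Type*) (k : V → ℕ) : Type _ := ∀ i : V, Fin (k i) → F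

/-- The positions of the codeword stored at node `i`: `k i` systematic symbols followed by `r i`
parity symbols.  Its length is `n i = k i + r i`. -/
abbrev Pos (k r : V → ℕ) (i : V) : Type := Fin (k i) ⊕ Fin (r i)

/-- The codeword `c_i = (m_i, ∑_j m_j A_{j,i})` stored at node `i`. -/
def codeword (P : ParityBlocks F k r) (m : Message F k) (i : V) : Pos k r i → F :=
  Sum.elim (m i) (∑ j, Matrix.vecMul (m j) (P j i))

/-- The additional local parities `∑_{j ≠ i} m_j A_{j,i}` contained in `c_i`. -/
def additionalParity (P : ParityBlocks F k r) (m : Message F k) (i : V) : Fin (r i) → F :=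
  ∑ j ∈ Finset.univ.erase i, Matrix.vecMul (m j) (P j i)

/-- The cross parities `m_i A_{i,j}` of node `i` at node `j`. -/
def crossParity (P : ParityBlocks F k r) (m : Message F k) (i j : V) : Fin (r j) → F :=
  Matrix.vecMul (m i) (P i j)

/-- The two words stored at node `i` for the messages `m`, `m'` agree in all the positions that are
not in the erasure set `E`. -/
def AgreeOff (P : ParityBlocks F k r) (i : V) (E : Finset (Pos k r i)) (m m' : Message F k) :
    Prop :=
  ∀ x, x ∉ E → codeword P m i x = codeword P m' i x

/-- Node `i` can recover its codeword from its non-erased symbols alone. -/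
def CorrectsLocally (P : ParityBlocks F k r) (i : V) (E : Finset (Pos k r i)) : Prop :=
  ∀ m m' : Message F k, AgreeOff P i E m m' → codeword P m i = codeword P m' i

/-- Node `i` can recover its codeword from its non-erased symbols and the codewords of all the
nodes in `R`. -/
def CorrectsGiven (P : ParityBlocks F k r) (i : V) (R : Finset V) (E : Finset (Pos k r i)) :
    Prop :=
  ∀ m m' : Message F k, AgreeOff P i E m m' →
    (∀ j ∈ R, codeword P m j = codeword P m' j) → codeword P m i = codeword P m' i

/-- When the nodes in `R` have recovered their messages, node `j` can compute the cross parities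
`m_i A_{i,j}` from its own codeword and the messages of the nodes in `R`. -/
def ProvidesCrossParity (P : ParityBlocks F k r) (i j : V) (R : Finset V) : Prop :=
  ∀ m m' : Message F k, codeword P m j = codeword P m' j → (∀ s ∈ R, m s = m' s) →
    crossParity P m i j = crossParity P m' i j

/-- The additional local parities of node `i` can be computed from the codewords of the nodes in
`R` (and then be removed from the parity part of `c_i`). -/
def AdditionalParityKnown (P : ParityBlocks F k r) (i : V) (R : Finset V) : Prop :=
  ∀ m m' : Message F k, (∀ j ∈ R, codeword P m j = codeword P m' j) →
    additionalParity P m i = additionalParity P m' i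

/-- The `ℓ`-th set of helpers `A^ℓ \ A^{ℓ-1}` of an increasing sequence `A` (for `1 ≤ ℓ`). -/
def helper (A : ℕ → Finset V) (ℓ : ℕ) : Finset V := A ℓ \ A (ℓ - 1)

/-- Cooperative decoding at node `i` with the assistance of the first to the `ℓ`-th level
cooperations, when the nodes in `A ℓ ∪ W` have recovered their messages.  Node `i` uses
* its own non-erased symbols;
* its additional local parities, provided that the codewords of the nodes in `A ℓ` determine them;
* for every level `1 ≤ ℓ' ≤ ℓ`, its cross parities at those helpers `j` of level `ℓ'` that can
  compute them in the `ℓ'`-th level cooperation, that is, from their own codeword and the messages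
  of the nodes in `A ℓ' ∪ W`.
The erasure set `E` is corrected if these data determine `c_i`. -/
def CorrectsCooperatively (P : ParityBlocks F k r) (i : V) (A : ℕ → Finset V) (ℓ : ℕ)
    (W : Finset V) (E : Finset (Pos k r i)) : Prop :=
  ∀ m m' : Message F k, AgreeOff P i E m m' →
    (AdditionalParityKnown P i (A ℓ) → additionalParity P m i = additionalParity P m' i) →
    (∀ ℓ' ∈ Finset.Icc 1 ℓ, ∀ j ∈ helper A ℓ', ProvidesCrossParity P i j (A ℓ' ∪ W) →
      crossParity P m i j = crossParity P m' i j) →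
    codeword P m i = codeword P m' i

/-- `e` is the maximal number of correctable erasures, for the notion of correctability `S` of sets
of erased positions: all sets of at most `e` positions are correctable, and some set of `e + 1`
positions is not, unless there are no `e + 1` positions at all. -/
def IsECCapability {α : Type*} [Fintype α] (S : Finset α → Prop) (e : ℕ) : Prop :=
  (∀ E : Finset α, E.card ≤ e → S E) ∧
    (e < Fintype.card α → ∃ E : Finset α, E.card = e + 1 ∧ ¬ S E)

/-- The EC hierarchy `(d 0, …, d L)` of depth `L` of node `i`, with the sets `A ℓ`, `B ℓ` and the
intermediate capabilities `lam ℓ W` for the sets `W` of recovered nodes. -/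
structure HasECHierarchy (P : ParityBlocks F k r) (i : V) (L : ℕ) (d : ℕ → ℕ)
    (A B : ℕ → Finset V) (lam : ℕ → Finset V → ℕ) : Prop where
  A_zero : A 0 = ∅
  A_strict : ∀ ℓ ∈ Finset.Icc 1 L, A (ℓ - 1) ⊂ A ℓ
  disjoint : ∀ ℓ ∈ Finset.Icc 1 L, Disjoint (A ℓ) (B ℓ)
  not_mem : ∀ ℓ ∈ Finset.Icc 1 L, i ∉ A ℓ ∧ i ∉ B ℓ
  /-- `d 0` is the maximal number of erasures that node `i` corrects locally. -/
  locally : IsECCapability (CorrectsLocally P i) (d 0)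
  /-- If the nodes in `A ℓ ∪ W` have recovered their codewords, then node `i` tolerates `lam ℓ W`
  erasures. -/
  tolerates : ∀ ℓ ∈ Finset.Icc 1 L, ∀ W ⊆ (Finset.Icc 1 ℓ).biUnion B,
    ∀ E : Finset (Pos k r i), E.card ≤ lam ℓ W → CorrectsGiven P i (A ℓ ∪ W) E
  /-- `lam ℓ W` is the maximal number of erasures that node `i` corrects with the first to the
  `ℓ`-th level cooperations if the nodes in `A ℓ ∪ W` have recovered their messages. -/
  capability : ∀ ℓ ∈ Finset.Icc 1 L, ∀ W ⊆ (Finset.Icc 1 ℓ).biUnion B,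
    IsECCapability (CorrectsCooperatively P i A ℓ W) (lam ℓ W)
  /-- `lam ℓ W` is smallest for `W = ∅`, and at most `d ℓ`. -/
  bounds : ∀ ℓ ∈ Finset.Icc 1 L, ∀ W ⊆ (Finset.Icc 1 ℓ).biUnion B,
    lam ℓ ∅ ≤ lam ℓ W ∧ lam ℓ W ≤ d ℓ
  /-- `d ℓ` is reached when the nodes in the sets `B ℓ'`, `1 ≤ ℓ' ≤ ℓ`, are recovered. -/
  reached : ∀ ℓ ∈ Finset.Icc 1 L, lam ℓ ((Finset.Icc 1 ℓ).biUnion B) = d ℓ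
  /-- No set `W` of recovered nodes whatsoever allows more than `d ℓ` erasures. -/
  maximal : ∀ ℓ ∈ Finset.Icc 1 L, ∀ W : Finset V, i ∉ W → d ℓ < k i + r i →
    ∃ E : Finset (Pos k r i), E.card = d ℓ + 1 ∧ ¬ CorrectsCooperatively P i A ℓ W E

end JointCodes

/-! ### Cooperation graphs -/

section CooperationGraphs

variable {V : Type*} [Fintype V] [DecidableEq V]

/-- A set of positions of a `V × V` matrix that forms a cycle of alternating horizontal and vertical
segments: each row and each column that meets it does so in exactly two positions, and it is
connected. -/
structure IsCoopCycle (C : Finset (V × V)) : Prop where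
  nonempty : C.Nonempty
  row_two : ∀ x ∈ C, (C.filter fun y => y.1 = x.1).card = 2
  col_two : ∀ x ∈ C, (C.filter fun y => y.2 = x.2).card = 2
  connected : ∀ S ⊆ C, S.Nonempty →
    (∀ x ∈ S, ∀ y ∈ C, x.1 = y.1 ∨ x.2 = y.2 → y ∈ S) → S = C

/-- A (topologically symmetric) cooperation graph with nodes `V` and cycles indexed by `T`.
* `M i`: the nodes with which node `i` cooperates in the first level;
* `L i`: the number of cooperation levels of node `i`;
* `cells t`: the vertices `(i, j)` (row `i`, column `j`) of the cycle `C_t`;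
* `group t`: the group number `g_t`;
* `level t j`: the cooperation level of node `j` at the vertices of `C_t` in column `j`. -/
structure CoopGraph (V : Type*) [Fintype V] [DecidableEq V] (T : Type*) where
  M : V → Finset V
  L : V → ℕ
  cells : T → Finset (V × V)
  group : T → ℕ
  level : T → V → ℕ
  M_nonempty : ∀ i, (M i).Nonempty
  not_mem_M : ∀ i, i ∉ M i
  M_symm : ∀ i j, j ∈ M i → i ∈ M j
  one_le_L : ∀ i, 1 ≤ L i
  isCycle : ∀ t, IsCoopCycle (cells t)
  /-- The vertices of the cycles are off-diagonal and are not used by the first level. -/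
  cells_off : ∀ t, ∀ x ∈ cells t, x.1 ≠ x.2 ∧ x.2 ∉ M x.1
  /-- The reflection of a cycle in the diagonal is again one of the cycles. -/
  symm : ∀ t, ∃ t', cells t' = (cells t).image Prod.swap
  level_mem : ∀ t, ∀ x ∈ cells t, level t x.2 ∈ Finset.Icc 2 (L x.2)

namespace CoopGraph

variable {T : Type*} [Fintype T] (C : CoopGraph V T)

/-- `X_t`: the rows of the cycle `C_t`. -/
def rows (t : T) : Finset V := (C.cells t).image Prod.fst

/-- `Y_t`: the columns of the cycle `C_t`. -/
def cols (t : T) : Finset V := (C.cells t).image Prod.snd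

/-- `X_{t;j}`: the rows of the vertices of `C_t` in column `j`. -/
def rowsAt (t : T) (j : V) : Finset V := ((C.cells t).filter fun x => x.2 = j).image Prod.fst

/-- `Y_{t;i}`: the columns of the vertices of `C_t` in row `i`. -/
def colsAt (t : T) (i : V) : Finset V := ((C.cells t).filter fun x => x.1 = i).image Prod.snd

/-- `T_g`: the cycles with group number `g`. -/
def cyclesOf (g : ℕ) : Finset T := Finset.univ.filter fun t => C.group t = g

/-- `A_i`: the group numbers of the cycles that meet column `i`. -/
def groupsAt (i : V) : Finset ℕ := (Finset.univ.filter fun t => i ∈ C.cols t).image C.group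

/-- `U_{j;g}`: the rows of the vertices in column `j` of the cycles in group `g`. -/
def groupRows (j : V) (g : ℕ) : Finset V := (C.cyclesOf g).biUnion fun t => C.rowsAt t j

/-- `R_{j;ℓ}`: the cycles that meet column `j` at the `ℓ`-th level of node `j`. -/
def colCycles (j : V) (ℓ : ℕ) : Finset T :=
  Finset.univ.filter fun t => j ∈ C.cols t ∧ C.level t j = ℓ

/-- `V_{j;ℓ}`: the rows of the vertices in column `j` of the cycles in `R_{j;ℓ}`. -/
def levelRows (j : V) (ℓ : ℕ) : Finset V := (C.colCycles j ℓ).biUnion fun t => C.rowsAt t j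

/-- `T_{i;ℓ}`: the cycles that meet row `i` at the `ℓ`-th level of node `i`, that is, the
reflections in the diagonal of the cycles in `R_{i;ℓ}`. -/
def rowCycles (i : V) (ℓ : ℕ) : Finset T :=
  Finset.univ.filter fun t => ∃ t' ∈ C.colCycles i ℓ, C.cells t = (C.cells t').image Prod.swap

/-- Compatibility of a cooperation graph with the graph `G` of the network. -/
structure IsCompatible (G : SimpleGraph V) : Prop where
  M_subset : ∀ i, ∀ j ∈ C.M i, G.Adj i j
  disjoint : ∀ t t', t ≠ t' → Disjoint (C.cells t) (C.cells t')
  clique : ∀ g : ℕ, ∃ S : Set V, Maximal G.IsClique S ∧ ∀ t ∈ C.cyclesOf g, ↑(C.cols t) ⊆ S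
  level_group : ∀ i, ∀ ℓ ∈ Finset.Icc 2 (C.L i),
    ∃! g, g ∈ C.groupsAt i ∧ C.levelRows i ℓ = C.groupRows i g

end CoopGraph

/-! ### The multi-level code over a cooperation graph -/

/-- The parameters of the code: message lengths `k`, syndrome lengths `r`, first-level parameters
`δ`, and `γ i t`, the number of parity symbols that the cycle `C_t` provides to node `i` (used for
rows `i` of `C_t` only). -/
structure CodeParams (V T : Type*) where
  k : V → ℕ
  r : V → ℕ
  δ : V → ℕ
  γ : V → T → ℕ

namespace CoopGraph

variable {T : Type*} [Fintype T] (C : CoopGraph V T) (p : CodeParams V T)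

/-- `η_{j;ℓ}`: the maximum of `γ_{i;t}` over the vertices `(i, j)` of the cycles `C_t` in
`R_{j;ℓ}`. -/
def eta (j : V) (ℓ : ℕ) : ℕ := (C.colCycles j ℓ).sup fun t => (C.rowsAt t j).sup fun i => p.γ i t

/-- The rows of the Cauchy matrix `T_i`: those of `A_{i,i}`, of `U_i`, and of `V_{i;ℓ}`,
`2 ≤ ℓ ≤ L_i`. -/
abbrev RowIdx (i : V) : Type :=
  Fin (p.k i) ⊕ Fin (p.δ i) ⊕ (Σ ℓ : {ℓ : ℕ // ℓ ∈ Finset.Icc 2 (C.L i)}, Fin (C.eta p i ℓ.1))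

/-- The columns of the Cauchy matrix `T_i`: those of `A_{i,i}`, of the `B_{i,j}`, `j ∈ M_i`, and of
the blocks `E_{i;ℓ;t}`.  The sets `T_{i;ℓ}`, `2 ≤ ℓ ≤ L_i`, partition the set of all cycles that
meet row `i`, so the blocks are indexed by the latter. -/
abbrev ColIdx (i : V) : Type _ :=
  Fin (p.r i) ⊕ (Σ j : {j : V // j ∈ C.M i}, Fin (p.δ j.1)) ⊕
    (Σ t : {t : T // i ∈ C.rows t}, Fin (p.γ i t.1))

variable {F : Type*} [Field F]

/-- The row indicators `a_i` and column indicators `b_i` of the Cauchy matrices `T_i`. -/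
structure Indicators (F : Type*) where
  a : ∀ i, C.RowIdx p i → F
  b : ∀ i, C.ColIdx p i → F
  distinct : ∀ i, Function.Injective (Sum.elim (a i) (b i))

variable {C p} (I : C.Indicators p F)

/-- The Cauchy matrix `T_i`. -/
def Indicators.cauchy (i : V) : Matrix (C.RowIdx p i) (C.ColIdx p i) F :=
  fun x y => (I.a i x - I.b i y)⁻¹

/-- `A_{i,i}`. -/
def Indicators.blockA (i : V) : Matrix (Fin (p.k i)) (Fin (p.r i)) F :=
  fun x y => I.cauchy i (Sum.inl x) (Sum.inl y)

/-- `U_i`. -/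
def Indicators.blockU (i : V) : Matrix (Fin (p.δ i)) (Fin (p.r i)) F :=
  fun x y => I.cauchy i (Sum.inr (Sum.inl x)) (Sum.inl y)

/-- `V_{i;ℓ}`. -/
def Indicators.blockV (i : V) (ℓ : ℕ) (h : ℓ ∈ Finset.Icc 2 (C.L i)) :
    Matrix (Fin (C.eta p i ℓ)) (Fin (p.r i)) F :=
  fun x y => I.cauchy i (Sum.inr (Sum.inr ⟨⟨ℓ, h⟩, x⟩)) (Sum.inl y)

/-- `B_{i,j}` for `j ∈ M_i`. -/
def Indicators.blockB (i j : V) (h : j ∈ C.M i) : Matrix (Fin (p.k i)) (Fin (p.δ j)) F :=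
  fun x y => I.cauchy i (Sum.inl x) (Sum.inr (Sum.inl ⟨⟨j, h⟩, y⟩))

/-- `E_{i;ℓ;t}` for a cycle `C_t` that meets row `i`. -/
def Indicators.blockE (i : V) (t : T) (h : i ∈ C.rows t) :
    Matrix (Fin (p.k i)) (Fin (p.γ i t)) F :=
  fun x y => I.cauchy i (Sum.inl x) (Sum.inr (Sum.inr ⟨⟨t, h⟩, y⟩))

/-- `B_{i,j} = [E_{i;ℓ;t}, 0]`, extended by zero columns to width `n`. -/
def Indicators.blockEPad (i : V) (t : T) (h : i ∈ C.rows t) (n : ℕ) :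
    Matrix (Fin (p.k i)) (Fin n) F :=
  fun x y => if hy : y.1 < p.γ i t then I.blockE i t h x ⟨y.1, hy⟩ else 0

/-- The parity blocks `A_{i,j}` of the multi-level code: the Cauchy block `A_{i,i}` if `i = j`;
`B_{i,j} U_j` if `j ∈ M_i`; `[E_{i;ℓ;t}, 0] V_{j;ℓ_{t;j}}` if `(i, j)` is a vertex of the cycle
`C_t` (there is at most one such `t` if the cycles are disjoint); and zero otherwise. -/
def Indicators.code (I : C.Indicators p F) : ParityBlocks F p.k p.r := fun i j =>
  if hij : i = j then hij ▸ I.blockA i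
  else if hM : j ∈ C.M i then I.blockB i j hM * I.blockU j
  else ∑ t : {t : T // (i, j) ∈ C.cells t},
    I.blockEPad i t.1 (Finset.mem_image_of_mem Prod.fst t.2) (C.eta p j (C.level t.1 j)) *
      I.blockV j (C.level t.1 j) (C.level_mem t.1 (i, j) t.2)

end CoopGraph

end CooperationGraphs

/-!
The whole argument takes place in the coordinates of the Cauchy matrices.  The parity part of `c_j`
is `syn m j` times the first `r j` columns of `T_j`, where the syndrome `syn m j` consists of the
message `m j`, the sum of the first-level symbols `m_s B_{s,j}`, and for each level `ℓ` the sum of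
the padded symbols `[m_s E_{s;t}, 0]` over the cycles `C_t` in `R_{j;ℓ}`.  Since `[U_j; V_j]` has at
most `r j` rows, `c_j` determines `syn m j` (`Indicators.codeword_eq_zero_iff`), and a node knows a
cross parity exactly if it knows its syndrome `crossSyn`.  By linearity all decoding problems
concern a single joint message whose known data vanish.

Local decoding is decoding of an MDS code of dimension `k + δ + ∑ η`, all of whose words occur
(`Indicators.isECCapability_local`); the MDS property is that of Cauchy matrices
(`eq_zero_of_cauchy_vecMul_eq_zero`).

The additional local parities of node `i` are determined by its first-level partners alone
(`Indicators.syn_inr_eq_zero_of_M`), and this is where characteristic 2 enters.  Each level of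
column `i` is one group of cycles, a cycle meets each of its rows in exactly two columns, so the
contributions of a group to all of its columns add up to zero; the other columns of the group are
first-level partners of `i`, which read their own contributions off their syndromes.

A helper `j` can compute a nonempty cross parity of `i` exactly if all the other messages that enter
the same component of `syn m j` have been recovered; otherwise a message of one of them conceals at least the
first symbol (`Indicators.provides_of_M`, `Indicators.provides_of_cells` and their converses).  The
symbols provided are the products of `m_i` with further columns of `T_i`.  If there are at most as
many erasures as known columns, `m_i` is determined, again because `T_i` is a Cauchy matrix; if there
are more, some nonzero message of node `i` alone satisfies all the equations
(`Indicators.correctsCooperatively`, `Indicators.not_correctsCooperatively`).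
-/

/-! ### Cauchy matrices -/

section Cauchy

variable {ρ κ F : Type*} [Fintype ρ] [Field F] {a : ρ → F} {b : κ → F}

/-- Every square submatrix of a Cauchy matrix is nonsingular: a vector supported on at most as many
rows as there are columns on which its product with the matrix vanishes is zero.  After clearing
denominators the product is the evaluation at `b y` of a polynomial of degree less than the number
of rows. -/
theorem eq_zero_of_cauchy_vecMul_eq_zero (h : Function.Injective (Sum.elim a b)) (s : Finset ρ)
    (K : Finset κ) (hcard : s.card ≤ K.card) (v : ρ → F) (hs : ∀ x, x ∉ s → v x = 0)
    (hK : ∀ y ∈ K, ∑ x, v x * (a x - b y)⁻¹ = 0) : v = 0 := by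
  classical
  have ha : Function.Injective a := fun x y hxy => Sum.inl_injective (h (by simpa using hxy))
  have hb : Function.Injective b := fun x y hxy => Sum.inr_injective (h (by simpa using hxy))
  have hab : ∀ x y, b y - a x ≠ 0 := fun x y hxy => by
    have : (Sum.elim a b) (Sum.inr y) = (Sum.elim a b) (Sum.inl x) := sub_eq_zero.mp hxy
    exact Sum.inr_ne_inl (h this)
  set N : Polynomial F := ∑ x ∈ s, Polynomial.C (v x) * Lagrange.nodal (s.erase x) a with hN
  have hdeg : N.degree < (K.card : ℕ) := by
    refine lt_of_lt_of_le ?_ (Nat.cast_le.mpr hcard)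
    rw [← Polynomial.mem_degreeLT]
    refine Submodule.sum_mem _ fun x hx => ?_
    rw [Polynomial.C_mul']
    refine Submodule.smul_mem _ _ ?_
    rw [Polynomial.mem_degreeLT, Lagrange.degree_nodal]
    exact_mod_cast Finset.card_erase_lt_of_mem hx
  have hN0 : N = 0 := by
    refine Polynomial.eq_zero_of_degree_lt_of_eval_index_eq_zero K hb.injOn hdeg fun y hy => ?_
    have h1 : ∑ x ∈ s, v x * (a x - b y)⁻¹ = 0 := by
      rw [← hK y hy]
      exact Finset.sum_subset (Finset.subset_univ s) fun x _ hx => by simp [hs x hx]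
    have h2 : N.eval (b y) = -(∏ x ∈ s, (b y - a x)) * ∑ x ∈ s, v x * (a x - b y)⁻¹ := by
      rw [hN, Polynomial.eval_finsetSum, Finset.mul_sum]
      refine Finset.sum_congr rfl fun x hx => ?_
      rw [Polynomial.eval_mul, Polynomial.eval_C, Lagrange.eval_nodal,
        ← Finset.mul_prod_erase s _ hx, ← neg_sub (b y) (a x), inv_neg]
      have := hab x y
      field_simp
    rw [h2, h1, mul_zero]
  funext x
  by_cases hx : x ∈ s
  · have h3 : N.eval (a x) = v x * ∏ x' ∈ s.erase x, (a x - a x') := by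
      rw [hN, Polynomial.eval_finsetSum, Finset.sum_eq_single x]
      · rw [Polynomial.eval_mul, Polynomial.eval_C, Lagrange.eval_nodal]
      · intro x' _ hne
        rw [Polynomial.eval_mul, Lagrange.eval_nodal_at_node (Finset.mem_erase.mpr ⟨hne.symm, hx⟩),
          mul_zero]
      · exact fun hx' => absurd hx hx'
    rw [hN0, Polynomial.eval_zero] at h3
    refine (mul_eq_zero.mp h3.symm).resolve_right ?_
    refine Finset.prod_ne_zero_iff.mpr fun x' hx' h0 => ?_
    exact Finset.ne_of_mem_erase hx' (ha (sub_eq_zero.mp h0)).symm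
  · exact hs x hx

/-- A Cauchy matrix with at least as many rows as columns maps row vectors onto all row vectors. -/
theorem exists_cauchy_vecMul_eq [Fintype κ] (h : Function.Injective (Sum.elim a b))
    (hcard : Fintype.card κ ≤ Fintype.card ρ) (w : κ → F) :
    ∃ v : ρ → F, ∀ y, ∑ x, v x * (a x - b y)⁻¹ = w y := by
  classical
  let N : Matrix ρ κ F := Matrix.of fun x y => (a x - b y)⁻¹
  have hinj : LinearMap.ker N.mulVecLin = ⊥ := by
    refine LinearMap.ker_eq_bot'.mpr fun u hu => ?_
    have h' : Function.Injective (Sum.elim b a) := by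
      have : Sum.elim b a = Sum.elim a b ∘ Sum.swap := by
        funext x; cases x <;> rfl
      rw [this]
      exact h.comp (Equiv.sumComm κ ρ).injective
    refine eq_zero_of_cauchy_vecMul_eq_zero h' Finset.univ Finset.univ
      (by simpa using hcard) u (by simp) fun y _ => ?_
    have h1 := congrFun hu y
    simp only [Matrix.mulVecLin_apply, Matrix.mulVec, dotProduct, N, Matrix.of_apply,
      Pi.zero_apply] at h1
    rw [← neg_eq_zero, ← h1, ← Finset.sum_neg_distrib]
    refine Finset.sum_congr rfl fun x _ => ?_
    rw [← neg_sub, inv_neg]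
    ring
  obtain ⟨g, hg⟩ := LinearMap.exists_leftInverse_of_injective _ hinj
  refine ⟨Matrix.vecMul w (LinearMap.toMatrix' g), fun y => ?_⟩
  have h2 : LinearMap.toMatrix' g * N = 1 := by
    rw [← LinearMap.toMatrix'_id, ← hg, LinearMap.toMatrix'_comp]
    congr 1
    exact (LinearMap.toMatrix'_toLin' N).symm
  have h3 : Matrix.vecMul (Matrix.vecMul w (LinearMap.toMatrix' g)) N = w := by
    rw [Matrix.vecMul_vecMul, h2, Matrix.vecMul_one]
  exact congrFun h3 y

end Cauchy

/-! ### Linearity of the decoding problems -/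

section Linear

variable {V F : Type*} [Field F] {k r : V → ℕ} (P : ParityBlocks F k r)

theorem crossParity_sub (m m' : Message F k) (i j : V) :
    crossParity P (m - m') i j = crossParity P m i j - crossParity P m' i j := by
  simp [crossParity, Matrix.sub_vecMul]

theorem crossParity_zero (i j : V) : crossParity P 0 i j = 0 := by
  simp [crossParity]

variable [Fintype V]

theorem codeword_sub (m m' : Message F k) (i : V) :
    codeword P (m - m') i = codeword P m i - codeword P m' i := by
  funext x
  cases x <;> simp [codeword, Matrix.sub_vecMul]

theorem codeword_zero (i : V) : codeword P 0 i = 0 := by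
  simpa using codeword_sub P 0 0 i

theorem codeword_inl (m : Message F k) (i : V) (x : Fin (k i)) :
    codeword P m i (Sum.inl x) = m i x := rfl

/-- By linearity it suffices to compare a joint message with zero. -/
theorem correctsLocally_iff (i : V) (E : Finset (Pos k r i)) :
    CorrectsLocally P i E ↔
      ∀ m : Message F k, (∀ x, x ∉ E → codeword P m i x = 0) → codeword P m i = 0 := by
  refine ⟨fun h m hm => ?_, fun h m m' hm => ?_⟩
  · rw [h m 0 fun x hx => by rw [hm x hx, codeword_zero, Pi.zero_apply], codeword_zero]
  · rw [← sub_eq_zero, ← codeword_sub]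
    exact h _ fun x hx => by rw [codeword_sub, Pi.sub_apply, hm x hx, sub_self]

theorem providesCrossParity_iff (i j : V) (R : Finset V) :
    ProvidesCrossParity P i j R ↔ ∀ m : Message F k, codeword P m j = 0 →
      (∀ s ∈ R, m s = 0) → crossParity P m i j = 0 := by
  refine ⟨fun h m hm hR => ?_, fun h m m' hm hR => ?_⟩
  · rw [h m 0 (by rw [hm, codeword_zero]) hR, crossParity_zero]
  · rw [← sub_eq_zero, ← crossParity_sub]
    exact h _ (by rw [codeword_sub, hm, sub_self]) fun s hs => by
      rw [Pi.sub_apply, hR s hs, sub_self]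

variable [DecidableEq V]

theorem additionalParity_sub (m m' : Message F k) (i : V) :
    additionalParity P (m - m') i = additionalParity P m i - additionalParity P m' i := by
  simp [additionalParity, Matrix.sub_vecMul]

theorem additionalParity_zero (i : V) : additionalParity P 0 i = 0 := by
  simp [additionalParity]

theorem additionalParityKnown_iff (i : V) (R : Finset V) :
    AdditionalParityKnown P i R ↔ ∀ m : Message F k, (∀ j ∈ R, codeword P m j = 0) →
      additionalParity P m i = 0 := by
  refine ⟨fun h m hm => ?_, fun h m m' hm => ?_⟩
  · rw [h m 0 fun j hj => by rw [hm j hj, codeword_zero], additionalParity_zero]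
  · rw [← sub_eq_zero, ← additionalParity_sub]
    exact h _ fun j hj => by rw [codeword_sub, hm j hj, sub_self]

theorem correctsCooperatively_iff (i : V) (A : ℕ → Finset V) (ℓ : ℕ) (W : Finset V)
    (E : Finset (Pos k r i)) :
    CorrectsCooperatively P i A ℓ W E ↔
      ∀ m : Message F k, (∀ x, x ∉ E → codeword P m i x = 0) →
        (AdditionalParityKnown P i (A ℓ) → additionalParity P m i = 0) →
        (∀ ℓ' ∈ Finset.Icc 1 ℓ, ∀ j ∈ helper A ℓ', ProvidesCrossParity P i j (A ℓ' ∪ W) →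
          crossParity P m i j = 0) → codeword P m i = 0 := by
  refine ⟨fun h m hm hadd hcross => ?_, fun h m m' hm hadd hcross => ?_⟩
  · rw [h m 0 (fun x hx => by rw [hm x hx, codeword_zero, Pi.zero_apply])
      (by simpa only [additionalParity_zero] using hadd)
      (by simpa only [crossParity_zero] using hcross), codeword_zero]
  · rw [← sub_eq_zero, ← codeword_sub]
    exact h _ (fun x hx => by rw [codeword_sub, Pi.sub_apply, hm x hx, sub_self])
      (fun hk => by rw [additionalParity_sub, hadd hk, sub_self])
      (fun ℓ' hℓ' j hj hp => by rw [crossParity_sub, hcross ℓ' hℓ' j hj hp, sub_self])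

/-- The data used by cooperative decoding are functions of the codewords of the nodes in
`A ℓ ∪ W`. -/
theorem CorrectsCooperatively.correctsGiven {P : ParityBlocks F k r} {i : V}
    {A : ℕ → Finset V} {ℓ : ℕ} {W : Finset V} {E : Finset (Pos k r i)}
    (hA : ∀ ℓ' ∈ Finset.Icc 1 ℓ, A ℓ' ⊆ A ℓ)
    (h : CorrectsCooperatively P i A ℓ W E) : CorrectsGiven P i (A ℓ ∪ W) E := by
  intro m m' hm hR
  refine h m m' hm (fun hk => hk m m' fun j hj => hR j (Finset.mem_union_left _ hj))
    fun ℓ' hℓ' j hj hp => ?_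
  have hsub : A ℓ' ∪ W ⊆ A ℓ ∪ W := Finset.union_subset_union_left (hA ℓ' hℓ')
  refine hp m m' (hR j (hsub (Finset.mem_union_left _ (Finset.mem_sdiff.mp hj).1))) fun s hs => ?_
  funext x
  exact congrFun (hR s (hsub hs)) (Sum.inl x)

theorem codeword_inr (m : Message F k) (i : V) (y : Fin (r i)) :
    codeword P m i (Sum.inr y) = Matrix.vecMul (m i) (P i i) y + additionalParity P m i y := by
  simp only [codeword, Sum.elim_inr, additionalParity]
  rw [← Finset.add_sum_erase Finset.univ _ (Finset.mem_univ i), Pi.add_apply]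

end Linear

/-! ### Combinatorics of cooperation graphs -/

namespace CoopGraph

section Combinatorics

variable {V : Type*} [Fintype V] [DecidableEq V] {T : Type*} (C : CoopGraph V T)

theorem mem_rowsAt {t : T} {i j : V} : i ∈ C.rowsAt t j ↔ (i, j) ∈ C.cells t := by
  simp [rowsAt]

theorem mem_colsAt {t : T} {i j : V} : j ∈ C.colsAt t i ↔ (i, j) ∈ C.cells t := by
  simp [colsAt]

theorem mem_cols {t : T} {j : V} : j ∈ C.cols t ↔ ∃ i, (i, j) ∈ C.cells t := by
  simp [cols]

theorem mem_rows {t : T} {i : V} : i ∈ C.rows t ↔ ∃ j, (i, j) ∈ C.cells t := by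
  simp [rows]

variable {C}

theorem mem_cells_of_swap {t t' : T} (h : C.cells t = (C.cells t').image Prod.swap) {i j : V} :
    (i, j) ∈ C.cells t ↔ (j, i) ∈ C.cells t' := by
  rw [h]; simp

theorem level_mem_Icc {t : T} {i j : V} (h : (i, j) ∈ C.cells t) :
    C.level t j ∈ Finset.Icc 2 (C.L j) := C.level_mem t _ h

theorem not_mem_M_of_mem_cells {t : T} {i j : V} (h : (i, j) ∈ C.cells t) :
    i ∉ C.M j := fun h' => (C.cells_off t _ h).2 (C.M_symm _ _ h')

theorem ne_of_mem_cells {t : T} {i j : V} (h : (i, j) ∈ C.cells t) : i ≠ j :=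
  (C.cells_off t _ h).1

theorem ne_of_mem_M {i j : V} (h : i ∈ C.M j) : i ≠ j := fun h' => C.not_mem_M j (h' ▸ h)

variable [Fintype T]

variable (C) in
theorem mem_colCycles {t : T} {j : V} {ℓ : ℕ} :
    t ∈ C.colCycles j ℓ ↔ j ∈ C.cols t ∧ C.level t j = ℓ := by
  simp [colCycles]

variable (C) in
theorem mem_levelRows {i j : V} {ℓ : ℕ} :
    i ∈ C.levelRows j ℓ ↔ ∃ t, (i, j) ∈ C.cells t ∧ C.level t j = ℓ := by
  simp only [levelRows, Finset.mem_biUnion, mem_colCycles, mem_rowsAt, mem_cols]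
  exact ⟨fun ⟨t, ⟨_, h1⟩, h2⟩ => ⟨t, h2, h1⟩, fun ⟨t, h2, h1⟩ => ⟨t, ⟨⟨i, h2⟩, h1⟩, h2⟩⟩

variable (C) in
theorem mem_rowCycles {t : T} {i : V} {ℓ : ℕ} :
    t ∈ C.rowCycles i ℓ ↔ ∃ t' ∈ C.colCycles i ℓ, C.cells t = (C.cells t').image Prod.swap := by
  simp [rowCycles]

variable (C) in
theorem mem_groupRows {i j : V} {g : ℕ} :
    i ∈ C.groupRows j g ↔ ∃ t, C.group t = g ∧ (i, j) ∈ C.cells t := by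
  simp [groupRows, cyclesOf, mem_rowsAt]

theorem rows_of_mem_rowCycles {t : T} {i : V} {ℓ : ℕ} (h : t ∈ C.rowCycles i ℓ) :
    i ∈ C.rows t := by
  obtain ⟨t', ht', hs⟩ := C.mem_rowCycles.mp h
  obtain ⟨j, hj⟩ := C.mem_cols.mp (C.mem_colCycles.mp ht').1
  exact C.mem_rows.mpr ⟨j, (mem_cells_of_swap hs).mpr hj⟩

theorem levelRows_disjoint_M (j : V) (ℓ : ℕ) : Disjoint (C.levelRows j ℓ) (C.M j) :=
  Finset.disjoint_left.mpr fun i hi => by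
    obtain ⟨t, ht, _⟩ := C.mem_levelRows.mp hi
    exact not_mem_M_of_mem_cells ht

theorem self_not_mem_levelRows (j : V) (ℓ : ℕ) : j ∉ C.levelRows j ℓ := fun hi => by
  obtain ⟨t, ht, _⟩ := C.mem_levelRows.mp hi
  exact ne_of_mem_cells ht rfl

/-- The reflected cycles `T_{i;ℓ}` meet row `i` in the columns `V_{i;ℓ}`. -/
theorem biUnion_colsAt (i : V) (ℓ : ℕ) :
    (C.rowCycles i ℓ).biUnion (fun t => C.colsAt t i) = C.levelRows i ℓ := by
  ext j
  simp only [Finset.mem_biUnion, mem_colsAt, mem_levelRows]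
  constructor
  · rintro ⟨t, ht, hij⟩
    obtain ⟨t', ht', hs⟩ := C.mem_rowCycles.mp ht
    exact ⟨t', (mem_cells_of_swap hs).mp hij, (C.mem_colCycles.mp ht').2⟩
  · rintro ⟨t', hji, hl⟩
    obtain ⟨t, hs⟩ := C.symm t'
    exact ⟨t, C.mem_rowCycles.mpr ⟨t', C.mem_colCycles.mpr ⟨C.mem_cols.mpr ⟨j, hji⟩, hl⟩, hs⟩,
      (mem_cells_of_swap hs).mpr hji⟩

variable {G : SimpleGraph V} (hC : C.IsCompatible G)
include hC

theorem IsCompatible.cycle_unique {t t' : T} {x : V × V} (h : x ∈ C.cells t)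
    (h' : x ∈ C.cells t') : t = t' := by
  by_contra hne
  exact Finset.disjoint_left.mp (hC.disjoint t t' hne) h h'

theorem IsCompatible.levelRows_nonempty {i : V} {ℓ : ℕ} (hℓ : ℓ ∈ Finset.Icc 2 (C.L i)) :
    (C.levelRows i ℓ).Nonempty := by
  obtain ⟨g, ⟨hg, he⟩, _⟩ := hC.level_group i ℓ hℓ
  simp only [groupsAt, Finset.mem_image, Finset.mem_filter, Finset.mem_univ, true_and,
    mem_cols] at hg
  obtain ⟨t, ⟨j, hj⟩, rfl⟩ := hg
  exact ⟨j, he ▸ C.mem_groupRows.mpr ⟨t, rfl, hj⟩⟩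

theorem IsCompatible.levelRows_disjoint (j : V) {ℓ ℓ' : ℕ} (h : ℓ ≠ ℓ') :
    Disjoint (C.levelRows j ℓ) (C.levelRows j ℓ') :=
  Finset.disjoint_left.mpr fun i hi hi' => by
    obtain ⟨t, ht, hl⟩ := C.mem_levelRows.mp hi
    obtain ⟨t', ht', hl'⟩ := C.mem_levelRows.mp hi'
    obtain rfl := hC.cycle_unique ht ht'
    exact h (hl.symm.trans hl')

theorem IsCompatible.rowCycles_disjoint (i : V) {ℓ ℓ' : ℕ} (h : ℓ ≠ ℓ') :
    Disjoint (C.rowCycles i ℓ) (C.rowCycles i ℓ') :=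
  Finset.disjoint_left.mpr fun t ht ht' => by
    obtain ⟨j, hj⟩ := C.mem_rows.mp (rows_of_mem_rowCycles ht)
    have hc := C.mem_colsAt.mpr hj
    have h1 : j ∈ C.levelRows i ℓ := biUnion_colsAt (C := C) i ℓ ▸
      Finset.mem_biUnion.mpr ⟨t, ht, hc⟩
    have h2 : j ∈ C.levelRows i ℓ' := biUnion_colsAt (C := C) i ℓ' ▸
      Finset.mem_biUnion.mpr ⟨t, ht', hc⟩
    exact Finset.disjoint_left.mp (hC.levelRows_disjoint i h) h1 h2

/-- The cycles at the `ℓ`-th level of column `i` are those of one group that meet the column. -/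
theorem IsCompatible.mem_colCycles_iff_group {i : V} {ℓ g : ℕ}
    (h : C.levelRows i ℓ = C.groupRows i g) {t : T} :
    t ∈ C.colCycles i ℓ ↔ C.group t = g ∧ i ∈ C.cols t := by
  constructor
  · intro ht
    obtain ⟨hc, hl⟩ := C.mem_colCycles.mp ht
    obtain ⟨j, hj⟩ := C.mem_cols.mp hc
    obtain ⟨t', hg, ht'⟩ := C.mem_groupRows.mp (h ▸ C.mem_levelRows.mpr ⟨t, hj, hl⟩)
    obtain rfl := hC.cycle_unique hj ht'
    exact ⟨hg, hc⟩
  · rintro ⟨hg, hc⟩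
    obtain ⟨j, hj⟩ := C.mem_cols.mp hc
    obtain ⟨t', ht', hl⟩ := C.mem_levelRows.mp (h.symm ▸ C.mem_groupRows.mpr ⟨t, hg, hj⟩)
    obtain rfl := hC.cycle_unique hj ht'
    exact C.mem_colCycles.mpr ⟨hc, hl⟩

/-- A group that meets column `i` occupies exactly one level of the column. -/
theorem IsCompatible.levelRows_eq_groupRows {i : V} {t : T} (ht : i ∈ C.cols t) :
    C.levelRows i (C.level t i) = C.groupRows i (C.group t) := by
  obtain ⟨j, hj⟩ := C.mem_cols.mp ht
  obtain ⟨g, ⟨_, he⟩, _⟩ := hC.level_group i _ (level_mem_Icc hj)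
  rw [((hC.mem_colCycles_iff_group he).mp (C.mem_colCycles.mpr ⟨ht, rfl⟩)).1, he]

end Combinatorics

end CoopGraph

/-! ### Syndromes -/

namespace CoopGraph

section Syndromes

variable {V T F : Type*} [Fintype V] [DecidableEq V] [Fintype T] [Field F] {C : CoopGraph V T}
  {p : CodeParams V T} (I : C.Indicators p F)

variable (C p) in
/-- The rows of `T_j` below those of `A_{j,j}`: the additional local parities of node `j` are a
combination of these rows, restricted to the first `r j` columns. -/
abbrev SynIdx (j : V) : Type :=
  Fin (p.δ j) ⊕ (Σ ℓ : {ℓ : ℕ // ℓ ∈ Finset.Icc 2 (C.L j)}, Fin (C.eta p j ℓ.1))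

/-- The first-level symbols `x B_{s,j}`, and `0` if `s` and `j` are not first-level partners. -/
def Indicators.bSym (s j : V) : (Fin (p.k s) → F) →ₗ[F] (Fin (p.δ j) → F) :=
  if h : j ∈ C.M s then (I.blockB s j h).vecMulLinear else 0

/-- The symbol `q` of `x E_{s;ℓ;t}`, padded with zeros to all `q : ℕ`, and `0` if `C_t` does not
meet row `s`. -/
def Indicators.eSym (s : V) (t : T) (q : ℕ) : (Fin (p.k s) → F) →ₗ[F] F :=
  if h : s ∈ C.rows t ∧ q < p.γ s t then
    (LinearMap.proj ⟨q, h.2⟩).comp (I.blockE s t h.1).vecMulLinear else 0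

/-- The coefficients, with respect to the rows `SynIdx j` of `T_j`, of the cross parities
`x A_{s,j}` of a message `x` of node `s`. -/
def Indicators.crossSyn (s j : V) : (Fin (p.k s) → F) →ₗ[F] (C.SynIdx p j → F) :=
  LinearMap.pi (Sum.elim (fun q => (LinearMap.proj q).comp (I.bSym s j))
    (fun z => ∑ t ∈ (C.colCycles j z.1.1).filter fun t => s ∈ C.rowsAt t j, I.eSym s t z.2))

/-- The coefficients, with respect to the rows of `T_j`, of the parity part of the codeword
`c_j`. -/
def Indicators.syn (m : Message F p.k) (j : V) : C.RowIdx p j → F :=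
  Sum.elim (m j) (∑ s ∈ Finset.univ.erase j, I.crossSyn s j (m s))

theorem Indicators.crossSyn_inl (s j : V) (x : Fin (p.k s) → F) (q : Fin (p.δ j)) :
    I.crossSyn s j x (Sum.inl q) = I.bSym s j x q := rfl

theorem Indicators.crossSyn_inr (s j : V) (x : Fin (p.k s) → F)
    (z : Σ ℓ : {ℓ : ℕ // ℓ ∈ Finset.Icc 2 (C.L j)}, Fin (C.eta p j ℓ.1)) :
    I.crossSyn s j x (Sum.inr z) =
      ∑ t ∈ (C.colCycles j z.1.1).filter fun t => s ∈ C.rowsAt t j, I.eSym s t z.2 x := by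
  simp [crossSyn, LinearMap.sum_apply]

theorem Indicators.bSym_eq_zero {s j : V} (h : s ∉ C.M j) : I.bSym s j = 0 :=
  dif_neg fun h' => h (C.M_symm _ _ h')

theorem gamma_le_eta {t : T} {s j : V} (h : (s, j) ∈ C.cells t) :
    p.γ s t ≤ C.eta p j (C.level t j) :=
  (Finset.le_sup (f := fun i => p.γ i t) (C.mem_rowsAt.mpr h)).trans
    (Finset.le_sup (f := fun t => (C.rowsAt t j).sup fun i => p.γ i t)
      (C.mem_colCycles.mpr ⟨C.mem_cols.mpr ⟨s, h⟩, rfl⟩))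

theorem Indicators.eSym_eq_zero {t : T} {s : V} {q : ℕ} (h : p.γ s t ≤ q) :
    I.eSym s t q = 0 :=
  dif_neg fun h' => absurd h'.2 (not_lt.mpr h)

theorem Indicators.crossSyn_inr_eq_zero {s j : V} (x : Fin (p.k s) → F)
    {z : Σ ℓ : {ℓ : ℕ // ℓ ∈ Finset.Icc 2 (C.L j)}, Fin (C.eta p j ℓ.1)}
    (h : s ∉ C.levelRows j z.1.1) : I.crossSyn s j x (Sum.inr z) = 0 := by
  rw [crossSyn_inr]
  refine Finset.sum_eq_zero fun t ht => ?_
  obtain ⟨ht, hs⟩ := Finset.mem_filter.mp ht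
  exact absurd (C.mem_levelRows.mpr ⟨t, C.mem_rowsAt.mp hs, (C.mem_colCycles.mp ht).2⟩) h

theorem Indicators.crossSyn_of_mem_M {s j : V} (h : s ∈ C.M j) (x : Fin (p.k s) → F) :
    I.crossSyn s j x = Sum.elim (I.bSym s j x) 0 := by
  funext y
  rcases y with q | z
  · rfl
  · exact I.crossSyn_inr_eq_zero x fun h' => Finset.disjoint_left.mp (levelRows_disjoint_M _ _) h' h

theorem Indicators.crossSyn_eq_zero {s j : V} (h : s ∉ C.M j) (h' : ∀ t, (s, j) ∉ C.cells t) :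
    I.crossSyn s j = 0 := by
  refine LinearMap.ext fun x => funext fun y => ?_
  rcases y with q | z
  · rw [crossSyn_inl, I.bSym_eq_zero h]; rfl
  · exact I.crossSyn_inr_eq_zero x fun h'' => by
      obtain ⟨t, ht, _⟩ := C.mem_levelRows.mp h''
      exact h' t ht

variable {G : SimpleGraph V} (hC : C.IsCompatible G)

include hC in
theorem Indicators.crossSyn_of_mem_cells {s j : V} {t : T} (h : (s, j) ∈ C.cells t)
    (x : Fin (p.k s) → F) :
    I.crossSyn s j x =
      Sum.elim (0 : Fin (p.δ j) → F) fun z => if z.1.1 = C.level t j then I.eSym s t z.2 x else 0 := by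
  funext y
  rcases y with q | z
  · rw [crossSyn_inl, I.bSym_eq_zero (not_mem_M_of_mem_cells h)]; rfl
  · rw [Sum.elim_inr]
    split_ifs with hz
    · rw [crossSyn_inr]
      refine Finset.sum_eq_single_of_mem t ?_ fun t' ht' hne => ?_
      · exact Finset.mem_filter.mpr ⟨C.mem_colCycles.mpr ⟨C.mem_cols.mpr ⟨s, h⟩, hz.symm⟩,
          C.mem_rowsAt.mpr h⟩
      · exact absurd (hC.cycle_unique (C.mem_rowsAt.mp (Finset.mem_filter.mp ht').2) h) hne
    · refine I.crossSyn_inr_eq_zero x fun h' => hz ?_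
      obtain ⟨t', ht', hl⟩ := C.mem_levelRows.mp h'
      obtain rfl := hC.cycle_unique ht' h
      exact hl.symm

theorem Indicators.vecMul_blockEPad {s : V} {t : T} (h : s ∈ C.rows t) (n : ℕ)
    (x : Fin (p.k s) → F) (q : Fin n) :
    Matrix.vecMul x (I.blockEPad s t h n) q = I.eSym s t q x := by
  by_cases hq : q.1 < p.γ s t
  · simp only [eSym, dif_pos (And.intro h hq), Matrix.vecMul, dotProduct, blockEPad, dif_pos hq,
      LinearMap.comp_apply, Matrix.vecMulLinear_apply, LinearMap.proj_apply]
  · rw [I.eSym_eq_zero (not_lt.mp hq)]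
    simp [Matrix.vecMul, dotProduct, blockEPad, dif_neg hq]

include hC in
theorem Indicators.crossParity_eq {s j : V} (hsj : s ≠ j) (m : Message F p.k) (y : Fin (p.r j)) :
    crossParity I.code m s j y =
      ∑ x, I.crossSyn s j (m s) x * I.cauchy j (Sum.inr x) (Sum.inl y) := by
  by_cases hM : j ∈ C.M s
  · rw [I.crossSyn_of_mem_M (C.M_symm _ _ hM), Fintype.sum_sum_type]
    simp only [crossParity, code, dif_neg hsj, dif_pos hM, ← Matrix.vecMul_vecMul, Sum.elim_inl,
      Sum.elim_inr, Pi.zero_apply, zero_mul, Finset.sum_const_zero, add_zero, bSym]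
    rfl
  · simp only [crossParity, code, dif_neg hsj, dif_neg hM]
    by_cases ht : ∃ t, (s, j) ∈ C.cells t
    · obtain ⟨t, ht⟩ := ht
      rw [Fintype.sum_eq_single (⟨t, ht⟩ : {t : T // (s, j) ∈ C.cells t}) fun t' hne =>
        absurd (Subtype.ext (hC.cycle_unique t'.2 ht)) hne]
      rw [I.crossSyn_of_mem_cells hC ht, Fintype.sum_sum_type, Fintype.sum_sigma,
        Fintype.sum_eq_single (⟨C.level t j, level_mem_Icc ht⟩ :
          {ℓ : ℕ // ℓ ∈ Finset.Icc 2 (C.L j)})]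
      · simp only [Sum.elim_inl, Sum.elim_inr, Pi.zero_apply, zero_mul, Finset.sum_const_zero,
          zero_add, if_true, ← Matrix.vecMul_vecMul]
        rw [Matrix.vecMul, dotProduct]
        exact Finset.sum_congr rfl fun q _ => congrArg
          (· * I.cauchy j (Sum.inr (Sum.inr ⟨⟨_, level_mem_Icc ht⟩, q⟩)) (Sum.inl y))
          (I.vecMul_blockEPad (C.mem_rows.mpr ⟨j, ht⟩) _ (m s) q)
      · intro ℓ hℓ
        refine Finset.sum_eq_zero fun q _ => ?_
        rw [Sum.elim_inr, if_neg fun h => hℓ (Subtype.ext h), zero_mul]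
    · have ht' : ∀ t, (s, j) ∉ C.cells t := fun t h => ht ⟨t, h⟩
      have : IsEmpty {t : T // (s, j) ∈ C.cells t} := ⟨fun t => ht' t.1 t.2⟩
      rw [I.crossSyn_eq_zero (fun h => hM (C.M_symm _ _ h)) ht']
      simp

include hC in
theorem Indicators.additionalParity_eq (m : Message F p.k) (j : V) (y : Fin (p.r j)) :
    additionalParity I.code m j y =
      ∑ x, I.syn m j (Sum.inr x) * I.cauchy j (Sum.inr x) (Sum.inl y) := by
  simp only [syn, Sum.elim_inr, Finset.sum_apply, Finset.sum_mul]
  rw [Finset.sum_comm, additionalParity, Finset.sum_apply]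
  exact Finset.sum_congr rfl fun s hs => I.crossParity_eq hC (Finset.ne_of_mem_erase hs) m y

theorem Indicators.code_self (j : V) : I.code j j = I.blockA j := dif_pos rfl

include hC in
/-- The codeword `c_j` is encoded from the syndrome `syn m j` by the first `r j` columns of the
Cauchy matrix `T_j`. -/
theorem Indicators.codeword_inr_eq (m : Message F p.k) (j : V) (y : Fin (p.r j)) :
    codeword I.code m j (Sum.inr y) = ∑ x, I.syn m j x * I.cauchy j x (Sum.inl y) := by
  rw [codeword_inr, I.additionalParity_eq hC, I.code_self]
  exact (Fintype.sum_sum_type fun x => I.syn m j x * I.cauchy j x (Sum.inl y)).symm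

variable (C p) in
theorem card_synIdx (j : V) :
    Fintype.card (C.SynIdx p j) = p.δ j + ∑ ℓ ∈ Finset.Icc 2 (C.L j), C.eta p j ℓ := by
  simp only [Fintype.card_sum, Fintype.card_sigma, Fintype.card_fin]
  rw [Finset.sum_coe_sort (Finset.Icc 2 (C.L j)) (fun ℓ => C.eta p j ℓ)]

variable (hlocal : ∀ i, p.δ i + ∑ ℓ ∈ Finset.Icc 2 (C.L i), C.eta p i ℓ ≤ p.r i)

include hlocal in
/-- The rows of `[U_j; V_j]` are linearly independent, as there are at most `r j` of them. -/
theorem Indicators.eq_zero_of_synIdx {j : V} (u : C.SynIdx p j → F)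
    (h : ∀ y, ∑ x, u x * I.cauchy j (Sum.inr x) (Sum.inl y) = 0) : u = 0 := by
  refine eq_zero_of_cauchy_vecMul_eq_zero (a := fun x => I.a j (Sum.inr x))
    (b := fun y => I.b j (Sum.inl y)) ?_ Finset.univ Finset.univ ?_ u (by simp) fun y _ => h y
  · have : Sum.elim (fun x => I.a j (Sum.inr x)) (fun y => I.b j (Sum.inl y)) =
        Sum.elim (I.a j) (I.b j) ∘ Sum.map Sum.inr Sum.inl := by
      funext x; cases x <;> rfl
    rw [this]
    exact (I.distinct j).comp (Sum.map_injective.mpr ⟨Sum.inr_injective, Sum.inl_injective⟩)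
  · rw [Finset.card_univ, card_synIdx, Finset.card_univ, Fintype.card_fin]
    exact hlocal j

include hC hlocal

theorem Indicators.crossParity_eq_zero_iff {s j : V} (hsj : s ≠ j) (m : Message F p.k) :
    crossParity I.code m s j = 0 ↔ I.crossSyn s j (m s) = 0 := by
  constructor
  · exact fun h => I.eq_zero_of_synIdx hlocal _ fun y => by rw [← I.crossParity_eq hC hsj, h]; rfl
  · exact fun h => funext fun y => by rw [I.crossParity_eq hC hsj, h]; simp

theorem Indicators.additionalParity_eq_zero_iff (m : Message F p.k) (j : V) :
    additionalParity I.code m j = 0 ↔ ∀ x, I.syn m j (Sum.inr x) = 0 := by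
  constructor
  · exact fun h => congrFun (I.eq_zero_of_synIdx hlocal (fun x => I.syn m j (Sum.inr x)) fun y => by
      rw [← I.additionalParity_eq hC, h]; rfl)
  · exact fun h => funext fun y => by rw [I.additionalParity_eq hC]; simp [h]

/-- A codeword determines its syndrome. -/
theorem Indicators.codeword_eq_zero_iff (m : Message F p.k) (j : V) :
    codeword I.code m j = 0 ↔ I.syn m j = 0 := by
  constructor
  · intro h
    have hm : m j = 0 := funext fun x => congrFun h (Sum.inl x)
    have ha : additionalParity I.code m j = 0 := funext fun y => by
      have h1 := congrFun h (Sum.inr y)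
      rwa [codeword_inr, hm, Matrix.zero_vecMul, Pi.zero_apply, zero_add] at h1
    funext x
    rcases x with x | x
    · exact congrFun hm x
    · exact (I.additionalParity_eq_zero_iff hC hlocal m j).mp ha x
  · intro h
    funext x
    rcases x with x | y
    · exact congrFun h (Sum.inl x)
    · rw [I.codeword_inr_eq hC, h]; simp

end Syndromes

end CoopGraph

/-! ### Additional parities and cross parities that can be computed -/

namespace CoopGraph

section Provides

variable {V T F : Type*} [Fintype V] [DecidableEq V] [Fintype T] [Field F] {C : CoopGraph V T}
  {p : CodeParams V T} (I : C.Indicators p F)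

/-- `B_{s,j}` has full column rank. -/
theorem Indicators.exists_bSym_eq {s j : V} (h : j ∈ C.M s) (hδ : p.δ j ≤ p.k s)
    (w : Fin (p.δ j) → F) : ∃ x, I.bSym s j x = w := by
  obtain ⟨x, hx⟩ := exists_cauchy_vecMul_eq (a := fun x => I.a s (Sum.inl x))
    (b := fun y => I.b s (Sum.inr (Sum.inl ⟨⟨j, h⟩, y⟩))) (by
      have : Sum.elim (fun x => I.a s (Sum.inl x))
          (fun y => I.b s (Sum.inr (Sum.inl ⟨⟨j, h⟩, y⟩))) =
          Sum.elim (I.a s) (I.b s) ∘ Sum.map Sum.inl (fun y => Sum.inr (Sum.inl ⟨⟨j, h⟩, y⟩)) := by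
        funext x; cases x <;> rfl
      rw [this]
      exact (I.distinct s).comp (Sum.map_injective.mpr ⟨Sum.inl_injective,
        Sum.inr_injective.comp (Sum.inl_injective.comp sigma_mk_injective)⟩)) (by simpa using hδ) w
  refine ⟨x, ?_⟩
  rw [bSym, dif_pos h]
  exact funext hx

/-- `E_{s;ℓ;t}` has full column rank. -/
theorem Indicators.exists_eSym_eq {s : V} {t : T} (h : s ∈ C.rows t) (hγ : p.γ s t ≤ p.k s)
    (w : ℕ → F) : ∃ x, ∀ q, q < p.γ s t → I.eSym s t q x = w q := by
  obtain ⟨x, hx⟩ := exists_cauchy_vecMul_eq (a := fun x => I.a s (Sum.inl x))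
    (b := fun y => I.b s (Sum.inr (Sum.inr ⟨⟨t, h⟩, y⟩))) (by
      have : Sum.elim (fun x => I.a s (Sum.inl x))
          (fun y => I.b s (Sum.inr (Sum.inr ⟨⟨t, h⟩, y⟩))) =
          Sum.elim (I.a s) (I.b s) ∘ Sum.map Sum.inl (fun y => Sum.inr (Sum.inr ⟨⟨t, h⟩, y⟩)) := by
        funext x; cases x <;> rfl
      rw [this]
      exact (I.distinct s).comp (Sum.map_injective.mpr ⟨Sum.inl_injective,
        Sum.inr_injective.comp (Sum.inr_injective.comp sigma_mk_injective)⟩)) (by simpa using hγ)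
    (fun q => w q)
  refine ⟨x, fun q hq => ?_⟩
  rw [eSym, dif_pos ⟨h, hq⟩]
  exact hx ⟨q, hq⟩

theorem Indicators.syn_add (m m' : Message F p.k) (j : V) :
    I.syn (m + m') j = I.syn m j + I.syn m' j := by
  funext x
  rcases x with x | x
  · rfl
  · simp [syn, Finset.sum_add_distrib]

theorem Indicators.syn_single_self (j : V) (x : Fin (p.k j) → F) :
    I.syn (Pi.single j x) j = Sum.elim x 0 := by
  rw [syn, Pi.single_eq_same, Finset.sum_eq_zero]
  intro s hs
  rw [Pi.single_eq_of_ne (Finset.ne_of_mem_erase hs), map_zero]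

theorem Indicators.syn_single {s j : V} (h : s ≠ j) (x : Fin (p.k s) → F) :
    I.syn (Pi.single s x) j = Sum.elim (0 : Fin (p.k j) → F) (I.crossSyn s j x) := by
  rw [syn, Pi.single_eq_of_ne h.symm, Finset.sum_eq_single_of_mem s (by simp [h]),
    Pi.single_eq_same]
  intro s' _ hne
  rw [Pi.single_eq_of_ne hne, map_zero]

theorem Indicators.syn_inr (m : Message F p.k) (j : V) (y : C.SynIdx p j) :
    I.syn m j (Sum.inr y) = ∑ s ∈ Finset.univ.erase j, I.crossSyn s j (m s) y := by
  simp [syn]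

theorem Indicators.message_eq_zero {m : Message F p.k} {j : V} (h : I.syn m j = 0) : m j = 0 :=
  funext fun x => congrFun h (Sum.inl x)

/-- The symbol `q` of the sum of the padded contributions of the rows of `C_t` to column `j`. -/
def Indicators.cycleSym (m : Message F p.k) (j : V) (t : T) (q : ℕ) : F :=
  ∑ s ∈ C.rowsAt t j, I.eSym s t q (m s)

/-- The component of the syndrome at level `ℓ`, summed by cycles instead of rows. -/
theorem Indicators.syn_level (m : Message F p.k) (j : V) (ℓ : ℕ) (hℓ : ℓ ∈ Finset.Icc 2 (C.L j))
    (q : Fin (C.eta p j ℓ)) :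
    I.syn m j (Sum.inr (Sum.inr ⟨⟨ℓ, hℓ⟩, q⟩)) =
      ∑ t ∈ C.colCycles j ℓ, I.cycleSym m j t q := by
  rw [syn_inr]
  simp only [crossSyn_inr, cycleSym, Finset.sum_filter]
  rw [Finset.sum_comm]
  refine Finset.sum_congr rfl fun t _ => ?_
  rw [← Finset.sum_filter]
  refine Finset.sum_congr ?_ fun _ _ => rfl
  ext s
  simp only [Finset.mem_filter, Finset.mem_erase, Finset.mem_univ, and_true,
    and_iff_right_iff_imp]
  exact fun hs => ne_of_mem_cells (C.mem_rowsAt.mp hs)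

/-- In characteristic 2 the contributions of a cycle to all of its columns cancel, because the
cycle meets each of its rows in exactly two columns. -/
theorem Indicators.sum_cycleSym [CharP F 2] (m : Message F p.k) (t : T) (q : ℕ) :
    ∑ j, I.cycleSym m j t q = 0 := by
  have h1 : ∑ j, I.cycleSym m j t q = ∑ x ∈ C.cells t, I.eSym x.1 t q (m x.1) := by
    rw [← Finset.sum_fiberwise (C.cells t) Prod.snd]
    refine Finset.sum_congr rfl fun j _ => ?_
    rw [cycleSym, rowsAt, Finset.sum_image]
    intro x hx y hy hxy
    rw [Finset.mem_coe, Finset.mem_filter] at hx hy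
    exact Prod.ext hxy (hx.2.trans hy.2.symm)
  rw [h1, ← Finset.sum_fiberwise (C.cells t) Prod.fst]
  refine Finset.sum_eq_zero fun s _ => ?_
  rw [Finset.sum_congr rfl (g := fun _ => I.eSym s t q (m s)) fun x hx => by
    rw [(Finset.mem_filter.mp hx).2], Finset.sum_const]
  rcases ((C.cells t).filter fun x => x.1 = s).eq_empty_or_nonempty with h0 | ⟨x, hx⟩
  · rw [h0, Finset.card_empty, zero_smul]
  · obtain ⟨hx', rfl⟩ := Finset.mem_filter.mp hx
    rw [(C.isCycle t).row_two x hx', two_nsmul, CharTwo.add_self_eq_zero]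

variable {G : SimpleGraph V} (hC : C.IsCompatible G)

include hC

/-- If `c_j` vanishes, then so do the sums of the contributions of each group to column `j`. -/
theorem Indicators.sum_group_cycleSym_eq_zero {m : Message F p.k} {j : V} (h : I.syn m j = 0)
    (g q : ℕ) : ∑ t ∈ C.cyclesOf g, I.cycleSym m j t q = 0 := by
  by_cases hg : ∃ t ∈ C.cyclesOf g, j ∈ C.cols t
  · obtain ⟨t, ht, hj⟩ := hg
    have hrows := hC.levelRows_eq_groupRows hj
    have hg' : C.group t = g := by simpa [cyclesOf] using ht
    have h1 : ∑ t ∈ C.cyclesOf g, I.cycleSym m j t q =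
        ∑ t' ∈ C.colCycles j (C.level t j), I.cycleSym m j t' q := by
      refine (Finset.sum_subset (fun t' ht' => ?_) fun t' ht' hn => ?_).symm
      · simpa [cyclesOf, hg'] using ((hC.mem_colCycles_iff_group hrows).mp ht').1
      · refine Finset.sum_eq_zero fun s hs => absurd ?_ hn
        refine (hC.mem_colCycles_iff_group hrows).mpr
          ⟨?_, C.mem_cols.mpr ⟨s, C.mem_rowsAt.mp hs⟩⟩
        simpa [cyclesOf, hg'] using ht'
    rw [h1]
    obtain ⟨s, hs⟩ := C.mem_cols.mp hj
    by_cases hq : q < C.eta p j (C.level t j)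
    · rw [← I.syn_level m j _ (level_mem_Icc hs) ⟨q, hq⟩, h]; rfl
    · refine Finset.sum_eq_zero fun t' ht' => Finset.sum_eq_zero fun s' hs' => ?_
      rw [I.eSym_eq_zero, LinearMap.zero_apply]
      rw [← (C.mem_colCycles.mp ht').2] at hq
      exact (gamma_le_eta (C.mem_rowsAt.mp hs')).trans (not_lt.mp hq)
  · refine Finset.sum_eq_zero fun t ht => Finset.sum_eq_zero fun s hs => ?_
    exact absurd ⟨t, ht, C.mem_cols.mpr ⟨s, C.mem_rowsAt.mp hs⟩⟩ hg

/-- The first-level partners of node `i` determine the additional local parities of node `i`.  The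
higher-level parts are those of the other columns of the same group, since the contributions of a
group to all its columns cancel. -/
theorem Indicators.syn_inr_eq_zero_of_M [CharP F 2]
    (hgroup : ∀ t t', C.group t = C.group t' →
      ∀ j ∈ C.cols t, ∀ j' ∈ C.cols t', j ≠ j' → j' ∈ C.M j)
    {m : Message F p.k} {i : V} (h : ∀ j ∈ C.M i, I.syn m j = 0) (y : C.SynIdx p i) :
    I.syn m i (Sum.inr y) = 0 := by
  rcases y with q | ⟨⟨ℓ, hℓ⟩, q⟩
  · rw [syn_inr]
    refine Finset.sum_eq_zero fun s _ => ?_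
    rw [crossSyn_inl]
    by_cases hs : s ∈ C.M i
    · rw [I.message_eq_zero (h s hs), map_zero]; rfl
    · rw [I.bSym_eq_zero hs]; rfl
  · rw [syn_level]
    obtain ⟨s, hs⟩ := hC.levelRows_nonempty hℓ
    obtain ⟨t, ht, hl⟩ := C.mem_levelRows.mp hs
    have hit : i ∈ C.cols t := C.mem_cols.mpr ⟨s, ht⟩
    have hrows := hC.levelRows_eq_groupRows hit
    rw [hl] at hrows
    have h1 : ∑ t' ∈ C.colCycles i ℓ, I.cycleSym m i t' q =
        ∑ t' ∈ C.cyclesOf (C.group t), I.cycleSym m i t' q := by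
      refine Finset.sum_subset (fun t' ht' => ?_) fun t' ht' hn => ?_
      · simpa [cyclesOf] using ((hC.mem_colCycles_iff_group hrows).mp ht').1
      · refine Finset.sum_eq_zero fun s hs => absurd ?_ hn
        refine (hC.mem_colCycles_iff_group hrows).mpr
          ⟨?_, C.mem_cols.mpr ⟨s, C.mem_rowsAt.mp hs⟩⟩
        simpa [cyclesOf] using ht'
    have h2 : ∑ j, ∑ t' ∈ C.cyclesOf (C.group t), I.cycleSym m j t' q = 0 := by
      rw [Finset.sum_comm]
      exact Finset.sum_eq_zero fun t' _ => I.sum_cycleSym m t' q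
    rw [h1, ← h2]
    refine (Fintype.sum_eq_single (f := fun j => ∑ t' ∈ C.cyclesOf (C.group t),
      I.cycleSym m j t' q) i fun j hji => ?_).symm
    by_cases hj : j ∈ C.M i
    · exact I.sum_group_cycleSym_eq_zero hC (h j hj) _ _
    · refine Finset.sum_eq_zero fun t' ht' => Finset.sum_eq_zero fun s' hs' => absurd ?_ hj
      refine hgroup t t' ?_ i hit j (C.mem_cols.mpr ⟨s', C.mem_rowsAt.mp hs'⟩) hji.symm
      exact (by simpa [cyclesOf] using ht' : C.group t' = C.group t).symm

variable (hlocal : ∀ i, p.δ i + ∑ ℓ ∈ Finset.Icc 2 (C.L i), C.eta p i ℓ ≤ p.r i)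

include hlocal

/-- The codewords of the first-level partners of node `i` suffice to remove its additional local
parities, including those of higher levels. -/
theorem Indicators.additionalParityKnown [CharP F 2]
    (hgroup : ∀ t t', C.group t = C.group t' →
      ∀ j ∈ C.cols t, ∀ j' ∈ C.cols t', j ≠ j' → j' ∈ C.M j)
    {i : V} {R : Finset V} (hR : C.M i ⊆ R) : AdditionalParityKnown I.code i R := by
  rw [additionalParityKnown_iff]
  intro m hm
  rw [I.additionalParity_eq_zero_iff hC hlocal]
  exact I.syn_inr_eq_zero_of_M hC hgroup fun j hj =>
    (I.codeword_eq_zero_iff hC hlocal m j).mp (hm j (hR hj))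

theorem Indicators.providesCrossParity_iff_syn {i j : V} (hij : i ≠ j) (R : Finset V) :
    ProvidesCrossParity I.code i j R ↔ ∀ m : Message F p.k, I.syn m j = 0 →
      (∀ s ∈ R, m s = 0) → I.crossSyn i j (m i) = 0 := by
  simp only [providesCrossParity_iff, I.codeword_eq_zero_iff hC hlocal,
    I.crossParity_eq_zero_iff hC hlocal hij]

/-- A first-level partner `j` computes `m_i A_{i,j}` if all its other first-level partners have
been recovered. -/
theorem Indicators.provides_of_M {i j : V} (hj : j ∈ C.M i) {R : Finset V}
    (hR : C.M j \ {i} ⊆ R) : ProvidesCrossParity I.code i j R := by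
  have hij : i ≠ j := (ne_of_mem_M hj).symm
  have hi : i ∈ C.M j := C.M_symm _ _ hj
  rw [I.providesCrossParity_iff_syn hC hlocal hij]
  intro m hm hmR
  rw [I.crossSyn_of_mem_M hi]
  funext y
  rcases y with q | z
  · have h1 := congrFun hm (Sum.inr (Sum.inl q))
    rw [syn_inr, Finset.sum_eq_single_of_mem i (by simp [hij])] at h1
    · exact h1
    · intro s _ hsi
      rw [crossSyn_inl]
      by_cases hs : s ∈ C.M j
      · rw [hmR s (hR (by simp [hs, hsi])), map_zero]; rfl
      · rw [I.bSym_eq_zero hs]; rfl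
  · rfl

/-- If another first-level partner `s` of `j` has not been recovered, its message can conceal
`m_i B_{i,j}`. -/
theorem Indicators.not_provides_of_M {i j s : V} (hj : j ∈ C.M i) (hδ0 : 0 < p.δ j)
    (hδ : ∀ i, ∀ j ∈ C.M i, p.δ j ≤ p.k i) (hs : s ∈ C.M j) (hsi : s ≠ i) {R : Finset V}
    (hsR : s ∉ R) (hiR : i ∉ R) : ¬ ProvidesCrossParity I.code i j R := by
  have hij : i ≠ j := (ne_of_mem_M hj).symm
  have hsj : s ≠ j := ne_of_mem_M hs
  have hi : i ∈ C.M j := C.M_symm _ _ hj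
  rw [I.providesCrossParity_iff_syn hC hlocal hij]
  intro h
  obtain ⟨x, hx⟩ := I.exists_bSym_eq hj (hδ i j hj) 1
  obtain ⟨y, hy⟩ := I.exists_bSym_eq (C.M_symm _ _ hs) (hδ s j (C.M_symm _ _ hs)) (-1)
  have h1 := h (Pi.single i x + Pi.single s y) (by
    rw [syn_add, I.syn_single hij, I.syn_single hsj, I.crossSyn_of_mem_M hi,
      I.crossSyn_of_mem_M hs, hx, hy]
    funext z
    rcases z with z | z | z <;> simp) fun s' hs' => by
      have hi' : s' ≠ i := fun h => hiR (h ▸ hs')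
      have hs'' : s' ≠ s := fun h => hsR (h ▸ hs')
      rw [Pi.add_apply, Pi.single_eq_of_ne hi', Pi.single_eq_of_ne hs'', add_zero]
  rw [Pi.add_apply, Pi.single_eq_same, Pi.single_eq_of_ne hsi.symm, add_zero,
    I.crossSyn_of_mem_M hi, hx] at h1
  exact one_ne_zero (congrFun h1 (Sum.inl ⟨0, hδ0⟩))

/-- A helper `j` in the row `i` of `C_t` computes `m_i A_{i,j}` if the other helpers of `j` at the
level of `C_t` in column `j` have been recovered. -/
theorem Indicators.provides_of_cells {i j : V} {t : T} (ht : (i, j) ∈ C.cells t) {R : Finset V}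
    (hR : C.levelRows j (C.level t j) \ {i} ⊆ R) : ProvidesCrossParity I.code i j R := by
  have hij : i ≠ j := ne_of_mem_cells ht
  rw [I.providesCrossParity_iff_syn hC hlocal hij]
  intro m hm hmR
  funext y
  rcases y with q | z
  · rw [I.crossSyn_of_mem_cells hC ht]; rfl
  · by_cases hz : z.1.1 = C.level t j
    · have h1 := congrFun hm (Sum.inr (Sum.inr z))
      rw [syn_inr, Finset.sum_eq_single_of_mem i (by simp [hij])] at h1
      · exact h1
      · intro s _ hsi
        by_cases hs : s ∈ C.levelRows j (C.level t j)
        · rw [hmR s (hR (by simp [hs, hsi])), map_zero]; rfl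
        · exact I.crossSyn_inr_eq_zero _ (hz ▸ hs)
    · rw [I.crossSyn_of_mem_cells hC ht, Sum.elim_inr, if_neg hz]; rfl

/-- If another helper `s` of `j` at the level of `C_t` has not been recovered, its message can
conceal the first symbol of `m_i E_{i;t}`. -/
theorem Indicators.not_provides_of_cells {i j s : V} {t : T} (ht : (i, j) ∈ C.cells t)
    (hγ : ∀ t, ∀ i ∈ C.rows t, 0 < p.γ i t ∧ p.γ i t ≤ p.k i)
    (hs : s ∈ C.levelRows j (C.level t j)) (hsi : s ≠ i) {R : Finset V}
    (hsR : s ∉ R) (hiR : i ∉ R) : ¬ ProvidesCrossParity I.code i j R := by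
  have hij : i ≠ j := ne_of_mem_cells ht
  obtain ⟨t', ht', hl⟩ := C.mem_levelRows.mp hs
  have hsj : s ≠ j := ne_of_mem_cells ht'
  have hi : i ∈ C.rows t := C.mem_rows.mpr ⟨j, ht⟩
  have hs' : s ∈ C.rows t' := C.mem_rows.mpr ⟨j, ht'⟩
  rw [I.providesCrossParity_iff_syn hC hlocal hij]
  intro h
  obtain ⟨x, hx⟩ := I.exists_eSym_eq hi (hγ t i hi).2 (Pi.single 0 1)
  obtain ⟨y, hy⟩ := I.exists_eSym_eq hs' (hγ t' s hs').2 (Pi.single 0 (-1))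
  -- Beyond `γ` the symbols are zero, so the two padded vectors are opposite unit vectors, even if
  -- the numbers `γ` of the two cycles differ.
  have hx' : ∀ q, I.eSym i t q x = Pi.single (M := fun _ => F) 0 1 q := fun q => by
    by_cases hq : q < p.γ i t
    · exact hx q hq
    · rw [I.eSym_eq_zero (not_lt.mp hq), Pi.single_eq_of_ne]; rfl
      exact fun h0 => hq (h0 ▸ (hγ t i hi).1)
  have hy' : ∀ q, I.eSym s t' q y = Pi.single (M := fun _ => F) 0 (-1) q := fun q => by
    by_cases hq : q < p.γ s t'
    · exact hy q hq
    · rw [I.eSym_eq_zero (not_lt.mp hq), Pi.single_eq_of_ne]; rfl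
      exact fun h0 => hq (h0 ▸ (hγ t' s hs').1)
  have h1 := h (Pi.single i x + Pi.single s y) (by
    rw [syn_add, I.syn_single hij, I.syn_single hsj, I.crossSyn_of_mem_cells hC ht,
      I.crossSyn_of_mem_cells hC ht', hl]
    funext z
    rcases z with z | z | z
    · simp
    · simp
    · simp only [Pi.add_apply, Sum.elim_inr, hx', hy', Pi.single_neg, Pi.neg_apply, Pi.zero_apply]
      split_ifs <;> simp) fun s' hs' => by
      have hi' : s' ≠ i := fun h => hiR (h ▸ hs')
      have hs'' : s' ≠ s := fun h => hsR (h ▸ hs')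
      rw [Pi.add_apply, Pi.single_eq_of_ne hi', Pi.single_eq_of_ne hs'', add_zero]
  rw [Pi.add_apply, Pi.single_eq_same, Pi.single_eq_of_ne hsi.symm, add_zero,
    I.crossSyn_of_mem_cells hC ht] at h1
  have h2 := congrFun h1 (Sum.inr ⟨⟨_, level_mem_Icc ht⟩,
    ⟨0, (hγ t i hi).1.trans_le (gamma_le_eta ht)⟩⟩)
  rw [Sum.elim_inr, if_pos rfl, hx', Pi.single_eq_same] at h2
  exact one_ne_zero h2

end Provides

end CoopGraph

/-! ### Erasure decoding with Cauchy matrices -/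

theorem card_pos_compl {V : Type*} {k r : V → ℕ} {i : V} (E : Finset (Pos k r i)) :
    Fintype.card {x // x ∉ E} + E.card = k i + r i := by
  have h1 := Fintype.card_subtype_compl (· ∈ E)
  have h2 := E.card_le_univ
  simp only [Fintype.card_coe, Fintype.card_sum, Fintype.card_fin] at h1 h2
  omega

namespace CoopGraph

section Decoding

variable {V T F : Type*} [Fintype V] [DecidableEq V] [Fintype T] [Field F] {C : CoopGraph V T}
  {p : CodeParams V T} (I : C.Indicators p F)

/-- A message `x` of node `i` is determined by the non-erased symbols of `(x, x A_{i,i})`, the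
symbols `x B_{i,j}`, `j ∈ S₁`, and the symbols `x E_{i;t}`, `t ∈ S₂`, if there are at most as many
erasures as known parity symbols. -/
theorem Indicators.eq_zero_of_symbols {i : V} {S₁ : Finset V} {S₂ : Finset T}
    (hS₁ : ∀ j ∈ S₁, j ∈ C.M i) (hS₂ : ∀ t ∈ S₂, i ∈ C.rows t) {E : Finset (Pos p.k p.r i)}
    (hcard : E.card ≤ p.r i + ∑ j ∈ S₁, p.δ j + ∑ t ∈ S₂, p.γ i t) {x : Fin (p.k i) → F}
    (hx : ∀ a, Sum.inl a ∉ E → x a = 0)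
    (hA : ∀ y, Sum.inr y ∉ E → Matrix.vecMul x (I.blockA i) y = 0)
    (hB : ∀ j ∈ S₁, I.bSym i j x = 0) (hE : ∀ t ∈ S₂, ∀ q, I.eSym i t q x = 0) : x = 0 := by
  let K : Finset (C.ColIdx p i) := (E.toRightᶜ).disjSum
    (((S₁.subtype (· ∈ C.M i)).sigma fun _ => Finset.univ).disjSum
      ((S₂.subtype (i ∈ C.rows ·)).sigma fun _ => Finset.univ))
  have hK : K.card = (p.r i - E.toRight.card) + (∑ j ∈ S₁, p.δ j + ∑ t ∈ S₂, p.γ i t) := by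
    simp only [K, Finset.card_disjSum, Finset.card_compl, Fintype.card_fin, Finset.card_sigma,
      Finset.card_univ]
    rw [Finset.sum_subtype_of_mem p.δ hS₁, Finset.sum_subtype_of_mem (p.γ i) hS₂]
  have hle : E.toRight.card ≤ p.r i := by simpa using E.toRight.card_le_univ
  have hadd := E.card_toLeft_add_card_toRight
  refine eq_zero_of_cauchy_vecMul_eq_zero (a := fun x => I.a i (Sum.inl x)) (b := I.b i) ?_
    E.toLeft K (by omega) x (fun a ha => hx a (by simpa using ha)) fun y hy => ?_
  · have : Sum.elim (fun x => I.a i (Sum.inl x)) (I.b i) =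
        Sum.elim (I.a i) (I.b i) ∘ Sum.map Sum.inl id := by
      funext x; cases x <;> rfl
    rw [this]
    exact (I.distinct i).comp (Sum.map_injective.mpr ⟨Sum.inl_injective, Function.injective_id⟩)
  · rcases y with y | ⟨⟨j, hj⟩, q⟩ | ⟨⟨t, ht⟩, q⟩
    · exact hA y (by simpa [K] using hy)
    · have h1 := hB j (by simpa [K] using hy)
      rw [bSym, dif_pos hj] at h1
      exact congrFun h1 q
    · have h1 := hE t (by simpa [K] using hy) q
      rw [eSym, dif_pos ⟨ht, q.2⟩] at h1
      exact h1

/-- With more erasures than known parity symbols there are more unknowns than equations. -/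
theorem Indicators.exists_ne_zero_of_symbols {i : V} (S₁ : Finset V) (S₂ : Finset T)
    {E : Finset (Pos p.k p.r i)}
    (hcard : p.r i + ∑ j ∈ S₁, p.δ j + ∑ t ∈ S₂, p.γ i t < E.card) :
    ∃ x : Fin (p.k i) → F, x ≠ 0 ∧ (∀ a, Sum.inl a ∉ E → x a = 0) ∧
      (∀ y, Sum.inr y ∉ E → Matrix.vecMul x (I.blockA i) y = 0) ∧
      (∀ j ∈ S₁, I.bSym i j x = 0) ∧ ∀ t ∈ S₂, ∀ q, I.eSym i t q x = 0 := by
  let f₀ : (Fin (p.k i) → F) →ₗ[F] ({x : Pos p.k p.r i // x ∉ E} → F) :=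
    LinearMap.pi fun x => Sum.elim (fun a => LinearMap.proj a)
      (fun y => (LinearMap.proj y).comp (I.blockA i).vecMulLinear) x.1
  let f₁ : (Fin (p.k i) → F) →ₗ[F] ((j : S₁) → Fin (p.δ j) → F) :=
    LinearMap.pi fun j => I.bSym i j
  let f₂ : (Fin (p.k i) → F) →ₗ[F] ((t : S₂) → Fin (p.γ i t) → F) :=
    LinearMap.pi fun t => LinearMap.pi fun q => I.eSym i t q
  have hker := LinearMap.ker_ne_bot_of_finrank_lt (f := f₀.prod (f₁.prod f₂)) (by
    simp only [Module.finrank_prod, Module.finrank_fintype_fun_eq_card, Module.finrank_pi_fintype,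
      Fintype.card_fin]
    rw [Finset.sum_coe_sort S₁ p.δ, Finset.sum_coe_sort S₂ (p.γ i)]
    have := card_pos_compl E
    omega)
  obtain ⟨x, hx, hx0⟩ := (Submodule.ne_bot_iff _).mp hker
  have h0 : f₀ x = 0 := congrArg Prod.fst (LinearMap.mem_ker.mp hx)
  have h1 : f₁ x = 0 := congrArg (fun z => z.2.1) (LinearMap.mem_ker.mp hx)
  have h2 : f₂ x = 0 := congrArg (fun z => z.2.2) (LinearMap.mem_ker.mp hx)
  refine ⟨x, hx0, fun a ha => congrFun h0 ⟨_, ha⟩, fun y hy => congrFun h0 ⟨_, hy⟩,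
    fun j hj => congrFun h1 ⟨j, hj⟩, fun t ht q => ?_⟩
  by_cases hq : q < p.γ i t
  · exact congrFun (congrFun h2 ⟨t, ht⟩) ⟨q, hq⟩
  · rw [I.eSym_eq_zero (not_lt.mp hq)]; rfl

variable {G : SimpleGraph V} (hC : C.IsCompatible G)

include hC in
/-- The maximum `η_{i;ℓ}` is attained, since no level is empty. -/
theorem IsCompatible.exists_gamma_eq_eta {i : V} {ℓ : ℕ} (hℓ : ℓ ∈ Finset.Icc 2 (C.L i)) :
    ∃ s t, (s, i) ∈ C.cells t ∧ C.level t i = ℓ ∧ p.γ s t = C.eta p i ℓ := by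
  obtain ⟨s, hs⟩ := hC.levelRows_nonempty hℓ
  obtain ⟨t, ht, hl⟩ := C.mem_levelRows.mp hs
  obtain ⟨t', ht', h1⟩ := Finset.exists_mem_eq_sup (C.colCycles i ℓ)
    ⟨t, C.mem_colCycles.mpr ⟨C.mem_cols.mpr ⟨s, ht⟩, hl⟩⟩
    fun t => (C.rowsAt t i).sup fun i => p.γ i t
  obtain ⟨hc, hl'⟩ := C.mem_colCycles.mp ht'
  obtain ⟨s', hs'⟩ := C.mem_cols.mp hc
  obtain ⟨s'', hs'', h2⟩ := Finset.exists_mem_eq_sup (C.rowsAt t' i)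
    ⟨s', C.mem_rowsAt.mpr hs'⟩ fun i => p.γ i t'
  exact ⟨s'', t', C.mem_rowsAt.mp hs'', hl', (h1.trans h2).symm⟩

include hC in
/-- All syndromes occur: the components at the rows of `U_i` are reached by the messages of one
first-level partner, and those at the rows of `V_{i;ℓ}` by the messages of a node `s` with `γ_{s;t} = η_{i;ℓ}`. -/
theorem Indicators.exists_syn_eq (hδ : ∀ i, ∀ j ∈ C.M i, p.δ j ≤ p.k i)
    (hγ : ∀ t, ∀ i ∈ C.rows t, 0 < p.γ i t ∧ p.γ i t ≤ p.k i) (i : V) (v : C.RowIdx p i → F) :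
    ∃ m, I.syn m i = v := by
  obtain ⟨s₀, hs₀⟩ := C.M_nonempty i
  obtain ⟨x₀, hx₀⟩ := I.exists_bSym_eq (C.M_symm _ _ hs₀) (hδ s₀ i (C.M_symm _ _ hs₀))
    (fun q => v (Sum.inr (Sum.inl q)))
  have key : ∀ ℓ : {ℓ : ℕ // ℓ ∈ Finset.Icc 2 (C.L i)}, ∃ m : Message F p.k,
      I.syn m i = Sum.elim (0 : Fin (p.k i) → F) (Sum.elim (0 : Fin (p.δ i) → F)
        fun z => if z.1 = ℓ then v (Sum.inr (Sum.inr z)) else 0) := by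
    intro ℓ
    obtain ⟨s, t, hst, hl, hmax⟩ := hC.exists_gamma_eq_eta (p := p) ℓ.2
    have hs : s ∈ C.rows t := C.mem_rows.mpr ⟨i, hst⟩
    obtain ⟨x, hx⟩ := I.exists_eSym_eq hs (hγ t s hs).2 fun q =>
      if h : q < C.eta p i ℓ.1 then v (Sum.inr (Sum.inr ⟨ℓ, ⟨q, h⟩⟩)) else 0
    refine ⟨Pi.single s x, ?_⟩
    rw [I.syn_single (ne_of_mem_cells hst), I.crossSyn_of_mem_cells hC hst, hl]
    refine congrArg (Sum.elim _) (congrArg (Sum.elim _) (funext fun z => ?_))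
    by_cases hz : z.1 = ℓ
    · obtain ⟨ℓ', q⟩ := z
      obtain rfl : ℓ' = ℓ := hz
      rw [if_pos rfl, if_pos rfl, hx q (q.2.trans_eq hmax.symm), dif_pos q.2]
    · rw [if_neg fun h => hz (Subtype.ext h), if_neg hz]
  choose μ hμ using key
  refine ⟨Pi.single i (fun a => v (Sum.inl a)) + Pi.single s₀ x₀ + ∑ ℓ, μ ℓ, ?_⟩
  have hsum : I.syn (∑ ℓ, μ ℓ) i = ∑ ℓ, I.syn (μ ℓ) i :=
    map_sum (AddMonoidHom.mk' (fun m => I.syn m i) fun m m' => I.syn_add m m' i) _ _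
  rw [syn_add, syn_add, syn_single_self, I.syn_single (ne_of_mem_M hs₀),
    I.crossSyn_of_mem_M hs₀, hx₀, hsum]
  funext y
  simp only [Pi.add_apply, Finset.sum_apply, hμ]
  rcases y with y | y | y <;> simp

variable (hlocal : ∀ i, p.δ i + ∑ ℓ ∈ Finset.Icc 2 (C.L i), C.eta p i ℓ ≤ p.r i)

include hC hlocal

/-- The local code of node `i` is an MDS code of dimension `k + δ + ∑ η`. -/
theorem Indicators.isECCapability_local (hk : ∀ i, 0 < p.k i)
    (hδ : ∀ i, ∀ j ∈ C.M i, p.δ j ≤ p.k i)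
    (hγ : ∀ t, ∀ i ∈ C.rows t, 0 < p.γ i t ∧ p.γ i t ≤ p.k i) (i : V) :
    IsECCapability (CorrectsLocally I.code i)
      (p.r i - (p.δ i + ∑ ℓ ∈ Finset.Icc 2 (C.L i), C.eta p i ℓ)) := by
  have hi := hlocal i
  have hki := hk i
  have hcardRow : Fintype.card (C.RowIdx p i) =
      p.k i + (p.δ i + ∑ ℓ ∈ Finset.Icc 2 (C.L i), C.eta p i ℓ) := by
    rw [← card_synIdx, Fintype.card_sum, Fintype.card_fin]
  constructor
  · intro E hE
    rw [correctsLocally_iff]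
    intro m hm
    rw [I.codeword_eq_zero_iff hC hlocal]
    have hle : E.toRight.card ≤ p.r i := by simpa using E.toRight.card_le_univ
    have hadd := E.card_toLeft_add_card_toRight
    refine eq_zero_of_cauchy_vecMul_eq_zero (a := I.a i) (b := fun y => I.b i (Sum.inl y)) ?_
      (E.toLeft.disjSum Finset.univ) E.toRightᶜ ?_ _ (fun y hy => ?_) fun y hy => ?_
    · have : Sum.elim (I.a i) (fun y => I.b i (Sum.inl y)) =
          Sum.elim (I.a i) (I.b i) ∘ Sum.map id Sum.inl := by
        funext x; cases x <;> rfl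
      rw [this]
      exact (I.distinct i).comp (Sum.map_injective.mpr ⟨Function.injective_id, Sum.inl_injective⟩)
    · rw [Finset.card_disjSum, Finset.card_univ, card_synIdx, Finset.card_compl, Fintype.card_fin]
      omega
    · rcases y with y | y
      · exact hm _ (by simpa using hy)
      · simp at hy
    · have h1 := hm (Sum.inr y) (by simpa using hy)
      rwa [I.codeword_inr_eq hC] at h1
  · intro hlt
    obtain ⟨E, -, hE⟩ := Finset.exists_subset_card_eq (s := (Finset.univ : Finset (Pos p.k p.r i)))
      (Nat.succ_le_of_lt hlt)
    refine ⟨E, hE, fun hcor => ?_⟩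
    let f : (C.RowIdx p i → F) →ₗ[F] ({x : Pos p.k p.r i // x ∉ E} → F) :=
      LinearMap.pi fun x => Sum.elim (fun a => LinearMap.proj (Sum.inl a))
        (fun y => (LinearMap.proj (Sum.inl y)).comp (I.cauchy i).vecMulLinear) x.1
    have hker := LinearMap.ker_ne_bot_of_finrank_lt (f := f) (by
      simp only [Module.finrank_fintype_fun_eq_card]
      rw [hcardRow]
      have := card_pos_compl E
      omega)
    obtain ⟨v, hv, hv0⟩ := (Submodule.ne_bot_iff _).mp hker
    obtain ⟨m, rfl⟩ := I.exists_syn_eq hC hδ hγ i v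
    refine hv0 ((I.codeword_eq_zero_iff hC hlocal m i).mp ?_)
    refine (correctsLocally_iff _ _ _).mp hcor m fun x hx => ?_
    have h1 := congrFun (LinearMap.mem_ker.mp hv) ⟨x, hx⟩
    rcases x with x | y
    · exact h1
    · rw [I.codeword_inr_eq hC]
      exact h1

/-- Sufficient condition for cooperative decoding: the symbols of the partners `S₁` and of the
cycles `S₂` are provided, and there are at most as many erasures as known parity symbols. -/
theorem Indicators.correctsCooperatively [CharP F 2]
    (hgroup : ∀ t t', C.group t = C.group t' →
      ∀ j ∈ C.cols t, ∀ j' ∈ C.cols t', j ≠ j' → j' ∈ C.M j)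
    {i : V} {A : ℕ → Finset V} {ℓ : ℕ} {W : Finset V} (hM : C.M i ⊆ A ℓ)
    {S₁ : Finset V} {S₂ : Finset T}
    (hS₁ : ∀ j ∈ S₁, j ∈ C.M i ∧ ∃ ℓ' ∈ Finset.Icc 1 ℓ, j ∈ helper A ℓ' ∧
      ProvidesCrossParity I.code i j (A ℓ' ∪ W))
    (hS₂ : ∀ t ∈ S₂, ∃ j, (i, j) ∈ C.cells t ∧ ∃ ℓ' ∈ Finset.Icc 1 ℓ, j ∈ helper A ℓ' ∧
      ProvidesCrossParity I.code i j (A ℓ' ∪ W))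
    {E : Finset (Pos p.k p.r i)}
    (hcard : E.card ≤ p.r i + ∑ j ∈ S₁, p.δ j + ∑ t ∈ S₂, p.γ i t) :
    CorrectsCooperatively I.code i A ℓ W E := by
  rw [correctsCooperatively_iff]
  intro m hm hadd hcross
  have ha := hadd (I.additionalParityKnown hC hlocal hgroup hM)
  have hpar : ∀ y, codeword I.code m i (Sum.inr y) = Matrix.vecMul (m i) (I.blockA i) y := by
    intro y
    rw [codeword_inr, ha, I.code_self, Pi.zero_apply, add_zero]
  have hm0 : m i = 0 := by
    refine I.eq_zero_of_symbols (fun j hj => (hS₁ j hj).1) (fun t ht => ?_) hcard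
      (fun a h => hm _ h) (fun y hy => hpar y ▸ hm _ hy) (fun j hj => ?_) fun t ht q => ?_
    · obtain ⟨j, hj, _⟩ := hS₂ t ht
      exact C.mem_rows.mpr ⟨j, hj⟩
    · obtain ⟨hjM, ℓ', hℓ', hj', hp⟩ := hS₁ j hj
      have h1 := hcross ℓ' hℓ' j hj' hp
      rw [I.crossParity_eq_zero_iff hC hlocal (ne_of_mem_M hjM).symm] at h1
      exact funext fun q => congrFun h1 (Sum.inl q)
    · obtain ⟨j, hj, ℓ', hℓ', hj', hp⟩ := hS₂ t ht
      have h1 := hcross ℓ' hℓ' j hj' hp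
      rw [I.crossParity_eq_zero_iff hC hlocal (ne_of_mem_cells hj),
        I.crossSyn_of_mem_cells hC hj] at h1
      by_cases hq : q < p.γ i t
      · have h2 := congrFun h1 (Sum.inr ⟨⟨_, level_mem_Icc hj⟩, ⟨q, hq.trans_le (gamma_le_eta hj)⟩⟩)
        rwa [Sum.elim_inr, if_pos rfl] at h2
      · rw [I.eSym_eq_zero (not_lt.mp hq)]; rfl
  funext x
  rcases x with x | y
  · exact congrFun hm0 x
  · rw [hpar, hm0, Matrix.zero_vecMul]; rfl

/-- If only the symbols of the partners `S₁` and of the cycles `S₂` are provided, then no larger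
set of erasures is corrected. -/
theorem Indicators.not_correctsCooperatively {i : V} {A : ℕ → Finset V} {ℓ : ℕ} {W : Finset V}
    (S₁ : Finset V) (S₂ : Finset T)
    (h : ∀ ℓ' ∈ Finset.Icc 1 ℓ, ∀ j ∈ helper A ℓ', ProvidesCrossParity I.code i j (A ℓ' ∪ W) →
      i ≠ j ∧ (j ∈ C.M i → 0 < p.δ j → j ∈ S₁) ∧ ∀ t, (i, j) ∈ C.cells t → t ∈ S₂)
    {E : Finset (Pos p.k p.r i)}
    (hcard : p.r i + ∑ j ∈ S₁, p.δ j + ∑ t ∈ S₂, p.γ i t < E.card) :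
    ¬ CorrectsCooperatively I.code i A ℓ W E := by
  obtain ⟨x, hx0, hx, hA, hB, hE⟩ := I.exists_ne_zero_of_symbols S₁ S₂ hcard
  have hxi : (Pi.single i x : Message F p.k) i = x := by
    rw [Pi.single_eq_same]
  have ha : additionalParity I.code (Pi.single i x) i = 0 := by
    rw [I.additionalParity_eq_zero_iff hC hlocal]
    intro y
    rw [syn_single_self]; rfl
  rw [correctsCooperatively_iff]
  intro hcor
  refine hx0 ?_
  have hc := hcor (Pi.single i x) (fun z hz => ?_) (fun _ => ha) fun ℓ' hℓ' j hj hp => ?_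
  · rw [← hxi]
    exact funext fun a => congrFun hc (Sum.inl a)
  · rcases z with a | y
    · rw [codeword_inl, hxi]; exact hx a hz
    · rw [codeword_inr, ha, hxi, I.code_self, hA y hz]; exact add_zero 0
  · obtain ⟨hij, h1, h2⟩ := h ℓ' hℓ' j hj hp
    rw [I.crossParity_eq_zero_iff hC hlocal hij, hxi]
    by_cases hjM : j ∈ C.M i
    · rw [I.crossSyn_of_mem_M (C.M_symm _ _ hjM)]
      funext y
      rcases y with q | z
      · rw [Sum.elim_inl, hB j (h1 hjM (q.1.zero_le.trans_lt q.2))]; rfl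
      · rfl
    · by_cases ht : ∃ t, (i, j) ∈ C.cells t
      · obtain ⟨t, ht⟩ := ht
        rw [I.crossSyn_of_mem_cells hC ht]
        funext y
        rcases y with q | z
        · rfl
        · rw [Sum.elim_inr, hE t (h2 t ht), ite_self]; rfl
      · rw [I.crossSyn_eq_zero (fun h => hjM (C.M_symm _ _ h)) fun t h => ht ⟨t, h⟩]; rfl

end Decoding

end CoopGraph

/-! ### The hierarchy -/

namespace CoopGraph

section Hierarchy

variable {V T : Type*} [Fintype V] [DecidableEq V] [Fintype T] (C : CoopGraph V T)
  (p : CodeParams V T)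

/-- `A_i^ℓ`: the first-level partners of node `i` and its helpers up to level `ℓ`. -/
def helpersUpTo (i : V) (ℓ : ℕ) : Finset V :=
  if ℓ = 0 then ∅ else C.M i ∪ (Finset.Icc 2 ℓ).biUnion (C.levelRows i)

/-- `B_i^ℓ`: the nodes that are not among the helpers of node `i` up to level `ℓ` and whose
messages conceal cross parities of node `i` at its helpers of level `ℓ`. -/
def concealing (i : V) (ℓ : ℕ) : Finset V :=
  if ℓ = 1 then (C.M i).biUnion fun j => C.M j \ ({i} ∪ C.M i)
  else (C.rowCycles i ℓ).biUnion fun t => (C.colsAt t i).biUnion fun j =>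
    helper (C.helpersUpTo j) (C.level t j) \ ({i} ∪ C.helpersUpTo i ℓ)

/-- The first-level partners of node `i` that provide cross parities when the nodes in `W` are
recovered. -/
def providingPartners (i : V) (W : Finset V) : Finset V :=
  (C.M i).filter fun j => C.M j \ {i} ⊆ C.M i ∪ W

/-- The cycles `t ∈ T_{i;ℓ}` for which some helper provides cross parities when the nodes in `W`
are recovered. -/
def providingCycles (i : V) (ℓ : ℕ) (W : Finset V) : Finset T :=
  (C.rowCycles i ℓ).filter fun t => ∃ j ∈ C.colsAt t i,
    helper (C.helpersUpTo j) (C.level t j) \ C.helpersUpTo i ℓ ⊆ {i} ∪ W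

/-- The intermediate capability `λ_{i,ℓ;W}`. -/
def capability (i : V) (ℓ : ℕ) (W : Finset V) : ℕ :=
  p.r i + ∑ j ∈ C.providingPartners i W, p.δ j +
    ∑ ℓ' ∈ Finset.Icc 2 ℓ, ∑ t ∈ C.providingCycles i ℓ' W, p.γ i t

/-- The capability `d_{i,ℓ}`. -/
def maxCapability (i : V) (ℓ : ℕ) : ℕ :=
  if ℓ = 0 then p.r i - (p.δ i + ∑ ℓ ∈ Finset.Icc 2 (C.L i), C.eta p i ℓ)
  else p.r i + ∑ j ∈ C.M i, p.δ j + ∑ ℓ' ∈ Finset.Icc 2 ℓ, ∑ t ∈ C.rowCycles i ℓ', p.γ i t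

variable {C}

theorem mem_helpersUpTo {i s : V} {ℓ : ℕ} (hℓ : 1 ≤ ℓ) :
    s ∈ C.helpersUpTo i ℓ ↔ s ∈ C.M i ∨ ∃ ℓ' ∈ Finset.Icc 2 ℓ, s ∈ C.levelRows i ℓ' := by
  rw [helpersUpTo, if_neg (by omega)]
  simp only [Finset.mem_union, Finset.mem_biUnion]

theorem helpersUpTo_mono (i : V) {ℓ ℓ' : ℕ} (hℓ : 1 ≤ ℓ) (h : ℓ ≤ ℓ') :
    C.helpersUpTo i ℓ ⊆ C.helpersUpTo i ℓ' := by
  intro s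
  rw [mem_helpersUpTo hℓ, mem_helpersUpTo (hℓ.trans h)]
  exact Or.imp_right fun ⟨ℓ'', h1, h2⟩ => ⟨ℓ'', Finset.Icc_subset_Icc_right h h1, h2⟩

theorem M_subset_helpersUpTo (i : V) {ℓ : ℕ} (hℓ : 1 ≤ ℓ) : C.M i ⊆ C.helpersUpTo i ℓ :=
  fun _ hs => (mem_helpersUpTo hℓ).mpr (Or.inl hs)

theorem helpersUpTo_one (i : V) : C.helpersUpTo i 1 = C.M i := by
  simp [helpersUpTo]

theorem helper_one (i : V) : helper (C.helpersUpTo i) 1 = C.M i := by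
  simp [helper, helpersUpTo]

theorem self_not_mem_helpersUpTo (i : V) (ℓ : ℕ) : i ∉ C.helpersUpTo i ℓ := by
  rcases Nat.eq_zero_or_pos ℓ with rfl | hℓ
  · simp [helpersUpTo]
  · rw [mem_helpersUpTo hℓ]
    rintro (h | ⟨ℓ', -, h⟩)
    · exact C.not_mem_M i h
    · exact self_not_mem_levelRows i ℓ' h

theorem concealing_one (i : V) :
    C.concealing i 1 = (C.M i).biUnion fun j => C.M j \ ({i} ∪ C.M i) := if_pos rfl

theorem concealing_of_two_le (i : V) {ℓ : ℕ} (hℓ : 2 ≤ ℓ) :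
    C.concealing i ℓ = (C.rowCycles i ℓ).biUnion fun t => (C.colsAt t i).biUnion fun j =>
      helper (C.helpersUpTo j) (C.level t j) \ ({i} ∪ C.helpersUpTo i ℓ) :=
  if_neg (by omega)

theorem disjoint_concealing (i : V) {ℓ : ℕ} (hℓ : 1 ≤ ℓ) :
    Disjoint ({i} ∪ C.helpersUpTo i ℓ) (C.concealing i ℓ) := by
  rcases hℓ.eq_or_lt with rfl | hℓ
  · rw [concealing_one, helpersUpTo_one, Finset.disjoint_biUnion_right]
    exact fun j _ => Finset.disjoint_sdiff
  · rw [concealing_of_two_le i hℓ, Finset.disjoint_biUnion_right]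
    intro t _
    rw [Finset.disjoint_biUnion_right]
    exact fun j _ => Finset.disjoint_sdiff

theorem self_not_mem_of_subset_concealing {i : V} {ℓ : ℕ} {W : Finset V}
    (hW : W ⊆ (Finset.Icc 1 ℓ).biUnion (C.concealing i)) : i ∉ W := fun h => by
  obtain ⟨ℓ', hℓ', hi⟩ := Finset.mem_biUnion.mp (hW h)
  exact Finset.disjoint_left.mp (disjoint_concealing i (Finset.mem_Icc.mp hℓ').1)
    (by simp) hi

theorem providingCycles_mono (i : V) (ℓ : ℕ) {W W' : Finset V} (h : W ⊆ W') :
    C.providingCycles i ℓ W ⊆ C.providingCycles i ℓ W' := fun t ht => by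
  obtain ⟨h1, j, hj, h2⟩ := Finset.mem_filter.mp ht
  exact Finset.mem_filter.mpr ⟨h1, j, hj, h2.trans (Finset.union_subset_union_right h)⟩

theorem capability_mono (i : V) (ℓ : ℕ) {W W' : Finset V} (h : W ⊆ W') :
    C.capability p i ℓ W ≤ C.capability p i ℓ W' :=
  add_le_add (add_le_add_right (Finset.sum_le_sum_of_subset (Finset.monotone_filter_right _
    fun _ _ hj => hj.trans (Finset.union_subset_union_right h))) _)
    (Finset.sum_le_sum fun ℓ' _ => Finset.sum_le_sum_of_subset (providingCycles_mono i ℓ' h))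

theorem capability_le (i : V) {ℓ : ℕ} (hℓ : 1 ≤ ℓ) (W : Finset V) :
    C.capability p i ℓ W ≤ C.maxCapability p i ℓ := by
  rw [maxCapability, if_neg (by omega)]
  exact add_le_add (add_le_add_right (Finset.sum_le_sum_of_subset (Finset.filter_subset _ _)) _)
    (Finset.sum_le_sum fun ℓ' _ => Finset.sum_le_sum_of_subset (Finset.filter_subset _ _))

/-- All helpers provide their cross parities once the concealing nodes have been recovered. -/
theorem capability_concealing (i : V) {ℓ : ℕ} (hℓ : 1 ≤ ℓ) :
    C.capability p i ℓ ((Finset.Icc 1 ℓ).biUnion (C.concealing i)) = C.maxCapability p i ℓ := by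
  have hsub : ∀ ℓ' ∈ Finset.Icc 1 ℓ,
      C.concealing i ℓ' ⊆ (Finset.Icc 1 ℓ).biUnion (C.concealing i) :=
    fun ℓ' h => Finset.subset_biUnion_of_mem _ h
  have h1 : C.providingPartners i ((Finset.Icc 1 ℓ).biUnion (C.concealing i)) = C.M i := by
    refine Finset.filter_true_of_mem fun j hj s hs => ?_
    by_cases hsM : s ∈ C.M i
    · exact Finset.mem_union_left _ hsM
    · refine Finset.mem_union_right _ (hsub 1 (by simp [hℓ]) ?_)
      rw [concealing_one]
      simp only [Finset.mem_sdiff, Finset.mem_singleton] at hs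
      exact Finset.mem_biUnion.mpr ⟨j, hj, by simp [hs, hsM]⟩
  have h2 : ∀ ℓ' ∈ Finset.Icc 2 ℓ,
      C.providingCycles i ℓ' ((Finset.Icc 1 ℓ).biUnion (C.concealing i)) = C.rowCycles i ℓ' := by
    intro ℓ' hℓ'
    obtain ⟨h2, h3⟩ := Finset.mem_Icc.mp hℓ'
    refine Finset.filter_true_of_mem fun t ht => ?_
    obtain ⟨j, hj⟩ := C.mem_rows.mp (rows_of_mem_rowCycles ht)
    have hj := C.mem_colsAt.mpr hj
    refine ⟨j, hj, fun s hs => ?_⟩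
    by_cases hsi : s = i
    · simp [hsi]
    · refine Finset.mem_union_right _ (hsub ℓ' (Finset.mem_Icc.mpr ⟨by omega, h3⟩) ?_)
      rw [concealing_of_two_le i h2]
      simp only [Finset.mem_sdiff] at hs
      exact Finset.mem_biUnion.mpr ⟨t, ht, Finset.mem_biUnion.mpr ⟨j, hj, by simp [hs, hsi]⟩⟩
  rw [capability, h1, maxCapability, if_neg (by omega)]
  exact congrArg _ (Finset.sum_congr rfl fun ℓ' hℓ' => by rw [h2 ℓ' hℓ'])

variable {G : SimpleGraph V} (hC : C.IsCompatible G)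

include hC

theorem IsCompatible.helper_eq_levelRows (i : V) {ℓ : ℕ} (hℓ : 2 ≤ ℓ) :
    helper (C.helpersUpTo i) ℓ = C.levelRows i ℓ := by
  ext s
  rw [helper, Finset.mem_sdiff, mem_helpersUpTo (by omega), mem_helpersUpTo (by omega)]
  constructor
  · rintro ⟨h1 | ⟨ℓ', hℓ', h1⟩, h2⟩
    · exact absurd (Or.inl h1) h2
    · rcases (Finset.mem_Icc.mp hℓ').2.eq_or_lt with rfl | hlt
      · exact h1
      · exact absurd (Or.inr ⟨ℓ', Finset.mem_Icc.mpr ⟨(Finset.mem_Icc.mp hℓ').1, by omega⟩, h1⟩) h2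
  · intro h
    refine ⟨Or.inr ⟨ℓ, Finset.mem_Icc.mpr ⟨hℓ, le_rfl⟩, h⟩, ?_⟩
    rintro (h1 | ⟨ℓ', hℓ', h1⟩)
    · exact Finset.disjoint_left.mp (levelRows_disjoint_M i ℓ) h h1
    · have hne : ℓ ≠ ℓ' := by have := (Finset.mem_Icc.mp hℓ').2; omega
      exact Finset.disjoint_left.mp (hC.levelRows_disjoint i hne) h h1

theorem IsCompatible.helpersUpTo_ssubset (i : V) {ℓ : ℕ} (hℓ : ℓ ∈ Finset.Icc 1 (C.L i)) :
    C.helpersUpTo i (ℓ - 1) ⊂ C.helpersUpTo i ℓ := by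
  obtain ⟨h1, h2⟩ := Finset.mem_Icc.mp hℓ
  have hne : (helper (C.helpersUpTo i) ℓ).Nonempty := by
    rcases h1.eq_or_lt with rfl | h1
    · rw [helper_one]; exact C.M_nonempty i
    · rw [hC.helper_eq_levelRows i h1]
      exact hC.levelRows_nonempty (Finset.mem_Icc.mpr ⟨h1, h2⟩)
  refine Finset.ssubset_iff_subset_ne.mpr ⟨?_, fun h => ?_⟩
  · rcases h1.eq_or_lt with rfl | h1
    · exact Finset.empty_subset _
    · exact helpersUpTo_mono i (by omega) (by omega)
  · rw [helper, h, Finset.sdiff_self] at hne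
    exact Finset.not_nonempty_empty hne

/-- A helper of node `i` at a cycle that meets row `i` helps at the level of that cycle. -/
theorem IsCompatible.two_le_and_mem_rowCycles {i j : V} {t : T} (ht : (i, j) ∈ C.cells t) {ℓ : ℕ}
    (hℓ : 1 ≤ ℓ) (hj : j ∈ helper (C.helpersUpTo i) ℓ) : 2 ≤ ℓ ∧ t ∈ C.rowCycles i ℓ := by
  rcases hℓ.eq_or_lt with rfl | hℓ
  · rw [helper_one] at hj
    exact absurd hj (C.cells_off t _ ht).2
  · rw [hC.helper_eq_levelRows i hℓ, ← biUnion_colsAt] at hj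
    obtain ⟨t', ht', hj⟩ := Finset.mem_biUnion.mp hj
    obtain rfl := hC.cycle_unique (C.mem_colsAt.mp hj) ht
    exact ⟨hℓ, ht'⟩

theorem IsCompatible.capability_eq (i : V) (ℓ : ℕ) (W : Finset V) [DecidableEq T] :
    C.capability p i ℓ W = p.r i + ∑ j ∈ C.providingPartners i W, p.δ j +
      ∑ t ∈ (Finset.Icc 2 ℓ).biUnion fun ℓ' => C.providingCycles i ℓ' W, p.γ i t :=
  congrArg _ (Finset.sum_biUnion fun _ _ _ _ h => (hC.rowCycles_disjoint i h).mono
    (Finset.filter_subset _ _) (Finset.filter_subset _ _)).symm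

variable {p} {F : Type*} [Field F] (I : C.Indicators p F)
  (hlocal : ∀ i, p.δ i + ∑ ℓ ∈ Finset.Icc 2 (C.L i), C.eta p i ℓ ≤ p.r i)

include hlocal

/-- The partners and cycles counted in `λ_{i,ℓ;W}` provide their symbols. -/
theorem Indicators.correctsCooperatively_capability [CharP F 2]
    (hgroup : ∀ t t', C.group t = C.group t' →
      ∀ j ∈ C.cols t, ∀ j' ∈ C.cols t', j ≠ j' → j' ∈ C.M j)
    {i : V} {ℓ : ℕ} (hℓ : 1 ≤ ℓ) {W : Finset V} {E : Finset (Pos p.k p.r i)}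
    (hE : E.card ≤ C.capability p i ℓ W) :
    CorrectsCooperatively I.code i (C.helpersUpTo i) ℓ W E := by
  classical
  refine I.correctsCooperatively hC hlocal hgroup (M_subset_helpersUpTo i hℓ)
    (S₁ := C.providingPartners i W)
    (S₂ := (Finset.Icc 2 ℓ).biUnion fun ℓ' => C.providingCycles i ℓ' W) (fun j hj => ?_)
    (fun t ht => ?_) ?_
  · obtain ⟨hj, hsub⟩ := Finset.mem_filter.mp hj
    refine ⟨hj, 1, Finset.mem_Icc.mpr ⟨le_rfl, hℓ⟩, by rwa [helper_one], ?_⟩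
    rw [helpersUpTo_one]
    exact I.provides_of_M hC hlocal hj hsub
  · obtain ⟨ℓ', hℓ', ht⟩ := Finset.mem_biUnion.mp ht
    obtain ⟨h2, h3⟩ := Finset.mem_Icc.mp hℓ'
    obtain ⟨ht, j, hj, hsub⟩ := Finset.mem_filter.mp ht
    have hc := C.mem_colsAt.mp hj
    refine ⟨j, hc, ℓ', Finset.mem_Icc.mpr ⟨by omega, h3⟩, ?_, ?_⟩
    · rw [hC.helper_eq_levelRows i h2, ← biUnion_colsAt]
      exact Finset.mem_biUnion.mpr ⟨t, ht, hj⟩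
    · rw [hC.helper_eq_levelRows j (Finset.mem_Icc.mp (level_mem_Icc hc)).1] at hsub
      refine I.provides_of_cells hC hlocal hc fun s hs => ?_
      obtain ⟨hs, hsi⟩ := Finset.mem_sdiff.mp hs
      by_cases hsA : s ∈ C.helpersUpTo i ℓ'
      · exact Finset.mem_union_left _ hsA
      · exact Finset.mem_union_right _ ((Finset.mem_union.mp
          (hsub (Finset.mem_sdiff.mpr ⟨hs, hsA⟩))).resolve_left hsi)
  · rwa [← hC.capability_eq]

/-- The partners and cycles not counted in `λ_{i,ℓ;W}` provide nothing, apart from empty blocks.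
This holds for all sets `W` of recovered nodes that do not contain `i`. -/
theorem Indicators.not_correctsCooperatively_capability
    (hδ : ∀ i, ∀ j ∈ C.M i, p.δ j ≤ p.k i)
    (hγ : ∀ t, ∀ i ∈ C.rows t, 0 < p.γ i t ∧ p.γ i t ≤ p.k i)
    {i : V} {ℓ : ℕ} {W : Finset V} (hiW : i ∉ W) {E : Finset (Pos p.k p.r i)}
    (hE : C.capability p i ℓ W < E.card) :
    ¬ CorrectsCooperatively I.code i (C.helpersUpTo i) ℓ W E := by
  classical
  refine I.not_correctsCooperatively hC hlocal (C.providingPartners i W)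
    ((Finset.Icc 2 ℓ).biUnion fun ℓ' => C.providingCycles i ℓ' W)
    (fun ℓ' hℓ' j hj hp => ?_) ?_
  · obtain ⟨h1, h2⟩ := Finset.mem_Icc.mp hℓ'
    have hiR : i ∉ C.helpersUpTo i ℓ' ∪ W := by
      simp [self_not_mem_helpersUpTo, hiW]
    refine ⟨fun h => self_not_mem_helpersUpTo (C := C) i ℓ' ?_, fun hjM hδ0 => ?_, fun t ht => ?_⟩
    · have hjA := (Finset.mem_sdiff.mp hj).1
      rwa [← h] at hjA
    · -- A first-level partner is a helper of no other level.
      obtain rfl : ℓ' = 1 := by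
        by_contra hne
        rw [hC.helper_eq_levelRows i (by omega)] at hj
        exact Finset.disjoint_left.mp (levelRows_disjoint_M i ℓ') hj hjM
      rw [helpersUpTo_one] at hp hiR
      refine Finset.mem_filter.mpr ⟨hjM, fun s hs => ?_⟩
      obtain ⟨hs, hsi⟩ := Finset.mem_sdiff.mp hs
      by_contra hsR
      exact I.not_provides_of_M hC hlocal hjM hδ0 hδ hs (by simpa using hsi) hsR hiR hp
    · obtain ⟨h3, htR⟩ := hC.two_le_and_mem_rowCycles ht h1 hj
      refine Finset.mem_biUnion.mpr ⟨ℓ', Finset.mem_Icc.mpr ⟨h3, h2⟩,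
        Finset.mem_filter.mpr ⟨htR, j, C.mem_colsAt.mpr ht, fun s hs => ?_⟩⟩
      rw [hC.helper_eq_levelRows j (Finset.mem_Icc.mp (level_mem_Icc ht)).1] at hs
      obtain ⟨hs, hsA⟩ := Finset.mem_sdiff.mp hs
      by_contra hsW
      simp only [Finset.mem_union, Finset.mem_singleton, not_or] at hsW
      exact I.not_provides_of_cells hC hlocal ht hγ hs hsW.1 (by simp [hsA, hsW.2]) hiR hp
  · rwa [← hC.capability_eq]

theorem Indicators.hasECHierarchy [CharP F 2]
    (hgroup : ∀ t t', C.group t = C.group t' →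
      ∀ j ∈ C.cols t, ∀ j' ∈ C.cols t', j ≠ j' → j' ∈ C.M j)
    (hk : ∀ i, 0 < p.k i) (hδ : ∀ i, ∀ j ∈ C.M i, p.δ j ≤ p.k i)
    (hγ : ∀ t, ∀ i ∈ C.rows t, 0 < p.γ i t ∧ p.γ i t ≤ p.k i) (i : V) :
    HasECHierarchy I.code i (C.L i) (C.maxCapability p i) (C.helpersUpTo i) (C.concealing i)
      (C.capability p i) := by
  have hex : ∀ e, e < p.k i + p.r i → ∃ E : Finset (Pos p.k p.r i), E.card = e + 1 := by
    intro e he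
    obtain ⟨E, -, hE⟩ := Finset.exists_subset_card_eq (s := (Finset.univ : Finset (Pos p.k p.r i)))
      (n := e + 1) (by simpa [Finset.card_univ] using he)
    exact ⟨E, hE⟩
  refine
    { A_zero := if_pos rfl
      A_strict := fun ℓ hℓ => hC.helpersUpTo_ssubset i hℓ
      disjoint := fun ℓ hℓ => (disjoint_concealing i (Finset.mem_Icc.mp hℓ).1).mono_left
        Finset.subset_union_right
      not_mem := fun ℓ hℓ => ⟨self_not_mem_helpersUpTo i ℓ,
        Finset.disjoint_left.mp (disjoint_concealing i (Finset.mem_Icc.mp hℓ).1) (by simp)⟩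
      locally := ?_
      tolerates := fun ℓ hℓ W _ E hE => ?_
      capability := fun ℓ hℓ W hW => ⟨fun E hE => ?_, fun hlt => ?_⟩
      bounds := fun ℓ hℓ W _ => ⟨capability_mono p i ℓ (Finset.empty_subset W),
        capability_le p i (Finset.mem_Icc.mp hℓ).1 W⟩
      reached := fun ℓ hℓ => capability_concealing p i (Finset.mem_Icc.mp hℓ).1
      maximal := fun ℓ hℓ W hiW hlt => ?_ }
  · rw [maxCapability, if_pos rfl]
    exact I.isECCapability_local hC hlocal hk hδ hγ i
  · refine (I.correctsCooperatively_capability hC hlocal hgroup (Finset.mem_Icc.mp hℓ).1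
      hE).correctsGiven fun ℓ' hℓ' => ?_
    exact helpersUpTo_mono i (Finset.mem_Icc.mp hℓ').1 (Finset.mem_Icc.mp hℓ').2
  · exact I.correctsCooperatively_capability hC hlocal hgroup (Finset.mem_Icc.mp hℓ).1 hE
  · obtain ⟨E, hE⟩ := hex _ (by simpa using hlt)
    exact ⟨E, hE, I.not_correctsCooperatively_capability hC hlocal hδ hγ
      (self_not_mem_of_subset_concealing hW) (by omega)⟩
  · obtain ⟨E, hE⟩ := hex _ hlt
    have := capability_le (C := C) p i (Finset.mem_Icc.mp hℓ).1 W
    exact ⟨E, hE, I.not_correctsCooperatively_capability hC hlocal hδ hγ hiW (by omega)⟩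

end Hierarchy

end CoopGraph

theorem mainTheorem1 {V T F : Type*} [Fintype V] [DecidableEq V] [Fintype T]
    [Field F] [Finite F] [CharP F 2]
    (G : SimpleGraph V) (C : CoopGraph V T) (hC : C.IsCompatible G)
    -- the columns of the cycles of one group cooperate with each other in the first level
    (hgroup : ∀ t t', C.group t = C.group t' →
      ∀ j ∈ C.cols t, ∀ j' ∈ C.cols t', j ≠ j' → j' ∈ C.M j)
    (p : CodeParams V T) (hk : ∀ i, 0 < p.k i) (hr : ∀ i, 0 < p.r i)
    (hlocal : ∀ i, p.δ i + ∑ ℓ ∈ Finset.Icc 2 (C.L i), C.eta p i ℓ ≤ p.r i)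
    (hδ : ∀ i, ∀ j ∈ C.M i, p.δ j ≤ p.k i)
    (hγ : ∀ t, ∀ i ∈ C.rows t, 0 < p.γ i t ∧ p.γ i t ≤ p.k i)
    (I : C.Indicators p F) :
    ∃ (d : V → ℕ → ℕ) (A B : V → ℕ → Finset V) (lam : V → ℕ → Finset V → ℕ),
      -- the code has these EC hierarchies
      (∀ i, HasECHierarchy I.code i (C.L i) (d i) (A i) (B i) (lam i)) ∧
      -- the EC capabilities
      (∀ i, (d i 0 : ℤ) = p.r i - p.δ i - ∑ ℓ ∈ Finset.Icc 2 (C.L i), (C.eta p i ℓ : ℤ)) ∧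
      (∀ i, d i 1 = p.r i + ∑ j ∈ C.M i, p.δ j) ∧
      (∀ i, ∀ ℓ ∈ Finset.Icc 2 (C.L i),
        d i ℓ = p.r i + ∑ j ∈ C.M i, p.δ j +
          ∑ ℓ' ∈ Finset.Icc 2 ℓ, ∑ t ∈ C.rowCycles i ℓ', p.γ i t) ∧
      -- the helpers
      (∀ i, helper (A i) 1 = C.M i) ∧
      (∀ i, ∀ ℓ ∈ Finset.Icc 2 (C.L i),
        helper (A i) ℓ = (C.colCycles i ℓ).biUnion (fun t => C.rowsAt t i) ∧
        helper (A i) ℓ = C.levelRows i ℓ) ∧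
      -- the nodes whose recovery lets the helpers provide cross parities
      (∀ i, B i 1 = (C.M i).biUnion fun j => C.M j \ ({i} ∪ C.M i)) ∧
      (∀ i, ∀ ℓ ∈ Finset.Icc 2 (C.L i),
        B i ℓ = (C.rowCycles i ℓ).biUnion fun t => (C.colsAt t i).biUnion fun j =>
          helper (A j) (C.level t j) \ ({i} ∪ A i ℓ)) ∧
      -- for each `t` in the set `T_{i;ℓ}`, the columns `Y_{t;i}` are helpers of level `ℓ`
      (∀ i, ∀ ℓ ∈ Finset.Icc 2 (C.L i),
        (C.rowCycles i ℓ).biUnion (fun t => C.colsAt t i) = helper (A i) ℓ) ∧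
      -- the intermediate capabilities
      (∀ i, ∀ ℓ ∈ Finset.Icc 1 (C.L i), ∀ W ⊆ (Finset.Icc 1 ℓ).biUnion (B i),
        lam i ℓ W = p.r i +
          ∑ j ∈ (C.M i).filter (fun j => C.M j \ {i} ⊆ C.M i ∪ W), p.δ j +
          ∑ ℓ' ∈ Finset.Icc 2 ℓ,
            ∑ t ∈ (C.rowCycles i ℓ').filter (fun t => ∃ j ∈ C.colsAt t i,
              helper (A j) (C.level t j) \ A i ℓ' ⊆ {i} ∪ W), p.γ i t) := by
  refine ⟨C.maxCapability p, C.helpersUpTo, C.concealing, C.capability p,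
    fun i => I.hasECHierarchy hC hlocal hgroup hk hδ hγ i, fun i => ?_, fun i => ?_,
    fun i ℓ hℓ => ?_, CoopGraph.helper_one, fun i ℓ hℓ => ?_, CoopGraph.concealing_one,
    fun i ℓ hℓ => ?_, fun i ℓ hℓ => ?_, fun i ℓ _ W _ => rfl⟩
  · rw [CoopGraph.maxCapability, if_pos rfl, Nat.cast_sub (hlocal i)]
    push_cast
    ring
  · simp [CoopGraph.maxCapability]
  · rw [CoopGraph.maxCapability, if_neg]
    have := (Finset.mem_Icc.mp hℓ).1
    omega
  · have h := hC.helper_eq_levelRows i (Finset.mem_Icc.mp hℓ).1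
    exact ⟨h, h⟩
  · exact CoopGraph.concealing_of_two_le i (Finset.mem_Icc.mp hℓ).1
  · rw [CoopGraph.biUnion_colsAt, hC.helper_eq_levelRows i (Finset.mem_Icc.mp hℓ).1]
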